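/- **Girth Conjecture.** For every integer $\gamma\ge 1$ there is a constant $c>0$ such that for all sufficiently large $n$ there is a graph with $n$ vertices, girth $2\gamma+2$ and minimum degree at least $c\,n^{1/\gamma}$. **Definitions.** Graphs are finite, simple, undirected and unweighted; the girth is the length of a shortest cycle ($\infty$ for forests), and $\mathrm{dist}_G(u,v)=\infty$ if $u,v$ are not connected. A *data structure with stretch function* $f:\mathbb N\to[0,\infty)$ for a class of graphs on the vertex set $\{1,\dots,n\}$ stores each graph $G$ of the class as a bit string, from which alone (with no restriction on the query time), for any two vertices $u,v$, an estimate in $[\mathrm{dist}_G(u,v),\,f(\mathrm{dist}_G(u,v))]$ is obtained, where $f(\infty)=\infty$. An *additive $\beta$-spanner* of $G$ is a subgraph $H$ on the same vertex set with $\mathrm{dist}_H(u,v)\le \mathrm{dist}_G(u,v)+\beta$ for all $u,v$. **Theorem.** Assume the Girth Conjecture. (1) Fix integers $\gamma\ge 1$ and $k\ge 2$. There is a function $\delta(n)=o(1)$, depending only on $\gamma$ and $k$, such that for every constant $c<\dfrac{2}{(\gamma(k-1))^{1-1/k}}$ and every $d_0$ there is an $n_0$ for which the following holds for all $n\ge n_0$.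 Every data structure that answers approximate distance queries on the class of $n$-vertex graphs of girth at least $2\gamma+1$, with a stretch function $f$ that satisfies $$f(d)<d+c\,d^{1-1/k}\qquad\text{for all } d\ge d_0,$$ occupies at least $$n^{\,1+\frac{1}{(\gamma+1)2^{k-1}-1}-\delta(n)}$$ bits on some graph of the class. (2) In particular, the exponent $1+\frac1{2\gamma+1}$ of the additive $6\gamma$-spanners of Baswana, Kavitha, Mehlhorn and Pettie, which have $O(n^{1+1/(2\gamma+1)})$ edges and exist in every $n$-vertex graph of girth at least $2\gamma+1$, cannot be improved, even for a larger constant additive stretch: for all integers $\gamma\ge1$, $\beta\ge 0$ and reals $\varepsilon>0$, $C$, for all sufficiently large $n$ there is an $n$-vertex graph of girth at least $2\gamma+1$ every additive $\beta$-spanner of which has more than $C\,n^{1+\frac{1}{2\gamma+1}-\varepsilon}$ edges. -/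

import Mathlib

open Filter Topology
open scoped NNReal ENNReal

/-- The Girth Conjecture, in its minimum-degree form: for every integer `γ ≥ 1` there is `c > 0`
such that for all sufficiently large `n` some graph on `n` vertices has girth `2γ + 2` and
minimum degree at least `c n^{1/γ}`. -/
def GirthConjecture : Prop :=
  ∀ γ : ℕ, 1 ≤ γ → ∃ c : ℝ, 0 < c ∧ ∀ᶠ n : ℕ in atTop,
    ∃ G : SimpleGraph (Fin n), G.egirth = ((2 * γ + 2 : ℕ) : ℕ∞) ∧
      ∀ v : Fin n, c * (n : ℝ) ^ (1 / (γ : ℝ)) ≤ ((G.neighborSet v).ncard : ℝ)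

/-- The graphs on the vertex set `Fin n` with girth at least `g` (forests have girth `⊤`). -/
abbrev GraphOfGirthAtLeast (g n : ℕ) : Type :=
  {G : SimpleGraph (Fin n) // (g : ℕ∞) ≤ G.egirth}

/-- A data structure answering approximate distance queries with stretch function `f` on the
`n`-vertex graphs of girth at least `g`. Each graph is stored as a bit string; a query `(u, v)`
is answered from the bit string alone, with no restriction on the query time, by an estimate in
`[dist(u, v), f(dist(u, v))]`, the distance and the estimate being `∞` if `u` and `v` are not
connected. -/
structure ApproxDistanceDataStructure (g n : ℕ) (f : ℕ → ℝ≥0) where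
  encode : GraphOfGirthAtLeast g n → List Bool
  query : List Bool → Fin n → Fin n → ℝ≥0∞
  edist_le_query : ∀ (G : GraphOfGirthAtLeast g n) (u v : Fin n),
    ((G.1.edist u v : ℕ∞) : ℝ≥0∞) ≤ query (encode G) u v
  query_le : ∀ (G : GraphOfGirthAtLeast g n) (u v : Fin n),
    G.1.Reachable u v → query (encode G) u v ≤ (f (G.1.dist u v) : ℝ≥0∞)

/-- `H` is an additive `β`-spanner of `G`: a subgraph on the same vertices that stretches every
distance by at most an additive `β`. -/
def IsAdditiveSpanner {V : Type*} (β : ℕ) (G H : SimpleGraph V) : Prop :=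
  H ≤ G ∧ ∀ u v : V, H.edist u v ≤ G.edist u v + (β : ℕ∞)

/-! The bound is a count. Suppose that graphs of girth at least `2γ + 1` are indexed by the sets `T`
of blocked pairs among `P` vertex pairs, and that the distance of a pair lies in `[C, D]` if it is
unblocked and is at least `C + Y` if it is blocked. If `f < C + Y` on `[C, D]`, then different `T`
need different codes, so some graph costs `P` bits (`Gadget.exists_long_encoding`). What is needed
are such gadgets with few vertices, many pairs, and a gap `C + Y - D` that is large compared with `D
^ (1 - 1/k)`.

Base gadgets have gap 2. For `γ = 1` they are complete bipartite graphs with edges deleted. For `γ ≥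
2`, a graph from the Girth Conjecture is used (`exists_girthGadget`): few hub vertices are reached
from all vertices by paths of length `γ` through many different first edges, and deleting a first
edge forces a detour of length at least `γ + 2`.

Composition (`Gadget.compose`, `HasGadgets.compose`) arranges copies of a gadget in `w` layers over
an abelian group and joins consecutive layers by paths of length `s`, each port shifting the group
element by its own displacement. A new pair belongs to a group element and an old pair `(a, b)`; its
route uses the ports `a, b, a, b, …`. The displacements come from points on a paraboloid, so by
strict convexity no other forward route has the same endpoints. Blocking the pair in all copies on
the route costs `Y` in each of them, while any backward move costs `2s ≥ w * Y`. So the gap is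
multiplied by `w`, and the exponent `α` of the number of pairs becomes `2α / (1 + α)`.

After `m = k - 1` rounds with `s = γ w ^ i` in round `i`, one has `D = γ w ^ m (1 + m (w + 1))`, gap
`2 w ^ m` and exponent `1 + 1 / ((γ + 1) 2 ^ m - 1)` (`exists_hasGadgets`). For large `w` the gap
approaches `2 (D / (γ m)) ^ (1 - 1/k)`, which is the constant of the theorem. Lower bounds on
distances and girth are certified throughout by integer potentials. Part (2) is the case `k = 2`,
since sparse additive spanners, written down edge by edge, form a data structure. -/

/-! ### Potentials as certificates for distances and girth -/

/-- An integer potential on a graph: it changes by at most one along every edge. -/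
def IsPotential {V : Type*} (G : SimpleGraph V) (h : V → ℤ) : Prop :=
  ∀ u v, G.Adj u v → h v ≤ h u + 1

namespace IsPotential

variable {V : Type*} {G H : SimpleGraph V} {h h' : V → ℤ}

lemma mono (hGH : H ≤ G) (hh : IsPotential G h) : IsPotential H h :=
  fun u v huv => hh u v (hGH huv)

lemma neg (hh : IsPotential G h) : IsPotential G (fun v => -h v) :=
  fun u v huv => by dsimp only; have := hh v u huv.symm; omega

lemma add_const (hh : IsPotential G h) (c : ℤ) : IsPotential G (fun v => h v + c) :=
  fun u v huv => by dsimp only; have := hh u v huv; omega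

lemma const_sub (hh : IsPotential G h) (c : ℤ) : IsPotential G (fun v => c - h v) :=
  fun u v huv => by dsimp only; have := hh v u huv.symm; omega

lemma min (hh : IsPotential G h) (hh' : IsPotential G h') :
    IsPotential G (fun v => Min.min (h v) (h' v)) :=
  fun u v huv => by dsimp only; have := hh u v huv; have := hh' u v huv; omega

lemma max (hh : IsPotential G h) (hh' : IsPotential G h') :
    IsPotential G (fun v => Max.max (h v) (h' v)) :=
  fun u v huv => by dsimp only; have := hh u v huv; have := hh' u v huv; omega

lemma const (G : SimpleGraph V) (c : ℤ) : IsPotential G (fun _ => c) :=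
  fun _ _ _ => by dsimp only; omega

lemma clamp (hh : IsPotential G h) (a b : ℤ) :
    IsPotential G (fun v => Min.min (Max.max (h v) a) b) :=
  (hh.max (const G a)).min (const G b)

/-- The walk lives in `G` and only has to avoid `E`, so that one walk can be tested against
potentials of different edge-deleted graphs. -/
lemma le_add_length_of_edges {E : Set (Sym2 V)} (hh : IsPotential (G.deleteEdges E) h)
    {u v : V} (p : G.Walk u v) (hp : ∀ e ∈ p.edges, e ∉ E) : h v ≤ h u + p.length := by
  induction p with
  | nil => simp
  | @cons a b c hab p ih =>
    have h1 := hh a b (by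
      rw [SimpleGraph.deleteEdges_adj]
      exact ⟨hab, hp _ (by simp)⟩)
    have h2 := ih (fun e he => hp e (by simp [he]))
    rw [SimpleGraph.Walk.length_cons]
    push_cast
    omega

lemma le_add_length (hh : IsPotential G h) {u v : V} (p : G.Walk u v) :
    h v ≤ h u + p.length := by
  refine le_add_length_of_edges (E := ∅) (hh.mono (SimpleGraph.deleteEdges_le _)) p ?_
  simp

lemma le_edist (hh : IsPotential G h) {u v : V} {n : ℕ} (hn : h u + n ≤ h v) :
    (n : ℕ∞) ≤ G.edist u v := by
  refine le_iInf fun p => ?_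
  have := hh.le_add_length p
  exact_mod_cast (by omega : n ≤ p.length)

end IsPotential

/-- Every edge `xy` carries a potential of the graph without `xy` that separates `x` and `y`
by at least `g`. -/
def EdgeSeparated {V : Type*} (g : ℕ) (G : SimpleGraph V) : Prop :=
  ∀ x y, G.Adj x y → ∃ h : V → ℤ, IsPotential (G.deleteEdges {s(x, y)}) h ∧ h x + g ≤ h y

/-- A cycle through `xy` consists of `xy` and a walk back from `y` to `x` without this edge, along
which the potential has to drop by `g`. -/
lemma EdgeSeparated.le_egirth {V : Type*} {g : ℕ} {G : SimpleGraph V} (hG : EdgeSeparated g G) :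
    ((g + 1 : ℕ) : ℕ∞) ≤ G.egirth := by
  rw [SimpleGraph.le_egirth]
  intro a w hw
  cases w with
  | nil => exact absurd rfl hw.ne_nil
  | @cons _ b _ hab p =>
    obtain ⟨hp, hne⟩ := (SimpleGraph.Walk.cons_isCycle_iff p hab).1 hw
    obtain ⟨h, hh, hxy⟩ := hG a b hab
    have := hh.neg.le_add_length_of_edges p (by
      intro e he h1
      rw [Set.mem_singleton_iff] at h1
      exact hne (h1 ▸ he))
    rw [SimpleGraph.Walk.length_cons]
    exact_mod_cast (by omega : g + 1 ≤ p.length + 1)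

lemma EdgeSeparated.mono {V : Type*} {g g' : ℕ} {G H : SimpleGraph V} (hg : g' ≤ g) (hH : H ≤ G)
    (hG : EdgeSeparated g G) : EdgeSeparated g' H := by
  intro x y hxy
  obtain ⟨h, hh, h1⟩ := hG x y (hH hxy)
  exact ⟨h, hh.mono (SimpleGraph.deleteEdges_mono hH), by omega⟩

/-- The distance to a vertex, cut off at `N`. -/
noncomputable def cutDist {V : Type*} (G : SimpleGraph V) (N : ℕ) (x v : V) : ℤ :=
  ((min (G.edist x v) N).toNat : ℤ)

lemma cutDist_self {V : Type*} (G : SimpleGraph V) (N : ℕ) (x : V) : cutDist G N x x = 0 := by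
  simp [cutDist]

lemma cutDist_eq {V : Type*} {G : SimpleGraph V} {N : ℕ} {x v : V} (h : (N : ℕ∞) ≤ G.edist x v) :
    cutDist G N x v = N := by
  simp [cutDist, min_eq_right h]

lemma isPotential_cutDist {V : Type*} (G : SimpleGraph V) (N : ℕ) (x : V) :
    IsPotential G (cutDist G N x) := by
  intro u v huv
  have h1 : G.edist x v ≤ G.edist x u + 1 :=
    (G.edist_triangle (v := u)).trans (by
      gcongr
      exact (SimpleGraph.edist_eq_one_iff_adj.2 huv).le)
  have h2 : min (G.edist x v) N ≤ min (G.edist x u) N + 1 := by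
    rcases le_total (G.edist x u) N with h | h
    · rw [min_eq_left h]; exact (min_le_left _ _).trans h1
    · rw [min_eq_right h]; exact (min_le_right _ _).trans le_self_add
  have h3 : min (G.edist x u) (N : ℕ∞) ≠ ⊤ := by simp
  have h4 := ENat.toNat_le_toNat h2 (by simp)
  rw [ENat.toNat_add h3 (by simp)] at h4
  simp only [cutDist]
  have h5 : ENat.toNat 1 = 1 := rfl
  omega

/-- The potential is the distance from `x` in the graph without `xy`. It is cut off at `g` because
`y` may be unreachable there. -/
lemma edgeSeparated_of_le_egirth {V : Type*} {g : ℕ} {G : SimpleGraph V}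
    (hG : ((g + 1 : ℕ) : ℕ∞) ≤ G.egirth) : EdgeSeparated g G := by
  classical
  intro x y hxy
  refine ⟨cutDist (G.deleteEdges {s(x, y)}) g x, isPotential_cutDist _ _ _, ?_⟩
  rw [cutDist_self, cutDist_eq, zero_add]
  refine le_iInf fun p => ?_
  have hp := p.bypass_isPath
  set r := p.bypass.reverse.mapLe (SimpleGraph.deleteEdges_le (G := G) {s(x, y)}) with hr
  have hc : (SimpleGraph.Walk.cons hxy r).IsCycle := by
    rw [SimpleGraph.Walk.cons_isCycle_iff]
    refine ⟨(SimpleGraph.Walk.isPath_mapLe _).2 hp.reverse, fun he => ?_⟩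
    rw [hr, SimpleGraph.Walk.edges_mapLe_eq_edges] at he
    have := SimpleGraph.Walk.edges_subset_edgeSet _ he
    simp at this
  have h1 := SimpleGraph.le_egirth.1 hG _ _ hc
  have h2 := p.length_bypass_le_length
  simp only [SimpleGraph.Walk.length_cons, hr, SimpleGraph.Walk.length_mapLe,
    SimpleGraph.Walk.length_reverse] at h1
  have h3 : g + 1 ≤ p.bypass.length + 1 := by exact_mod_cast h1
  exact_mod_cast (by omega : g ≤ p.length)

/-! ### Gluing graphs in layers -/

/-- A layered scheme over the group `A`: in each of `m` steps, the copy of `V` at `z : A` is joined,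
for every label `c` that is valid in this step, to the copy at `z + dir c` in the next layer,
by a path of length `s` from `src j c` to `tgt j c`. -/
structure LayeredScheme (A V K : Type) where
  m : ℕ
  s : ℕ
  s_pos : 0 < s
  valid : ℕ → K → Prop
  dir : K → A
  src : ℕ → K → V
  tgt : ℕ → K → V

namespace LayeredScheme

variable {A V K : Type} [AddCommGroup A] (S : LayeredScheme A V K)

/-- The `q`-th vertex of the connecting path with label `c` that starts in layer `j` at `z`. -/
def pt (j : ℕ) (z : A) (c : K) (q : ℕ) : ℕ × A × (V ⊕ K × ℕ) :=
  if q = 0 then (j, z, .inl (S.src j c))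
  else if q < S.s then (j, z, .inr (c, q))
  else (j + 1, z + S.dir c, .inl (S.tgt j c))

/-- The generating relation of `LayeredScheme.glue`. -/
inductive Rel (inner : ℕ → A → SimpleGraph V) :
    ℕ × A × (V ⊕ K × ℕ) → ℕ × A × (V ⊕ K × ℕ) → Prop
  | inner (j : ℕ) (z : A) (v v' : V) (h : (inner j z).Adj v v') :
      Rel inner (j, z, .inl v) (j, z, .inl v')
  | path (j : ℕ) (z : A) (c : K) (q : ℕ) (hj : j < S.m) (hc : S.valid j c) (hq : q < S.s) :
      Rel inner (S.pt j z c q) (S.pt j z c (q + 1))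

/-- The graph glued from the graphs `inner j z` according to a layered scheme. -/
def glue (inner : ℕ → A → SimpleGraph V) : SimpleGraph (ℕ × A × (V ⊕ K × ℕ)) :=
  SimpleGraph.fromRel (S.Rel inner)

lemma pt_zero (j : ℕ) (z : A) (c : K) : S.pt j z c 0 = (j, z, .inl (S.src j c)) := by
  simp [pt]

lemma pt_s (j : ℕ) (z : A) (c : K) :
    S.pt j z c S.s = (j + 1, z + S.dir c, .inl (S.tgt j c)) := by
  have := S.s_pos
  simp [pt, this.ne']

lemma pt_of_lt (j : ℕ) (z : A) (c : K) {q : ℕ} (hq : 0 < q) (hqs : q < S.s) :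
    S.pt j z c q = (j, z, .inr (c, q)) := by
  simp [pt, hq.ne', hqs]

lemma pt_of_le (j : ℕ) (z : A) (c : K) {q : ℕ} (hqs : S.s ≤ q) :
    S.pt j z c q = (j + 1, z + S.dir c, .inl (S.tgt j c)) := by
  have := S.s_pos
  simp [pt, (this.trans_le hqs).ne', hqs.not_gt]

variable {S} {inner : ℕ → A → SimpleGraph V}

lemma isPotential_glue_of_rel {h : ℕ × A × (V ⊕ K × ℕ) → ℤ} 
    (hrel : ∀ x y, S.Rel inner x y → h y ≤ h x + 1 ∧ h x ≤ h y + 1) :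
    IsPotential (S.glue inner) h := by
  intro x y hxy
  rw [glue, SimpleGraph.fromRel_adj] at hxy
  rcases hxy.2 with h1 | h1
  · exact (hrel _ _ h1).1
  · exact (hrel _ _ h1).2

/-- Potentials on the inner graphs that fit together extend to the connecting paths. -/
lemma exists_isPotential_glue (h₀ : ℕ → A → V → ℤ) (hin : ∀ j z, IsPotential (inner j z) (h₀ j z))
    (hst : ∀ j, j < S.m → ∀ z c, S.valid j c →
      h₀ (j + 1) (z + S.dir c) (S.tgt j c) ≤ h₀ j z (S.src j c) + S.s ∧
      h₀ j z (S.src j c) ≤ h₀ (j + 1) (z + S.dir c) (S.tgt j c) + S.s) :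
    ∃ h : ℕ × A × (V ⊕ K × ℕ) → ℤ, IsPotential (S.glue inner) h ∧
      ∀ j z v, h (j, z, .inl v) = h₀ j z v := by
  -- At position `q` the value at the far end is clamped to within `q` of the value at the source:
  -- the potential moves at unit speed and then stays constant.
  let F : ℕ → A → K → ℕ → ℤ := fun j z c q =>
    min (h₀ j z (S.src j c) + q) (max (h₀ (j + 1) (z + S.dir c) (S.tgt j c))
      (h₀ j z (S.src j c) - q))
  let h : ℕ × A × (V ⊕ K × ℕ) → ℤ := fun x =>
    Sum.elim (fun v => h₀ x.1 x.2.1 v) (fun cq => F x.1 x.2.1 cq.1 cq.2) x.2.2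
  have hpt : ∀ j, j < S.m → ∀ z c, S.valid j c → ∀ q, q ≤ S.s →
      h (S.pt j z c q) = F j z c q := by
    intro j hj z c hc q hq
    have h1 := hst j hj z c hc
    have hs := S.s_pos
    rcases Nat.eq_zero_or_pos q with rfl | hq0
    · rw [pt_zero]; simp only [h, F, Sum.elim_inl]; push_cast; omega
    · rcases hq.lt_or_eq with hq | rfl
      · simp [pt, hq0.ne', hq, h]
      · rw [pt_s]; simp only [h, F, Sum.elim_inl]; omega
  refine ⟨h, isPotential_glue_of_rel ?_, fun j z v => rfl⟩
  rintro x y (⟨j, z, v, v', hv⟩ | ⟨j, z, c, q, hj, hc, hq⟩)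
  · exact ⟨hin j z v v' hv, hin j z v' v hv.symm⟩
  · rw [hpt j hj z c hc q hq.le, hpt j hj z c hc (q + 1) hq]
    simp only [F]
    push_cast
    omega

lemma glue_adj_inner {j : ℕ} {z : A} {v v' : V} (h : (inner j z).Adj v v') :
    (S.glue inner).Adj (j, z, .inl v) (j, z, .inl v') := by
  rw [glue, SimpleGraph.fromRel_adj]
  exact ⟨fun he => h.ne (by simpa using he), .inl (.inner j z v v' h)⟩

lemma edist_glue_inner_le (j : ℕ) (z : A) (v v' : V) :
    (S.glue inner).edist (j, z, .inl v) (j, z, .inl v') ≤ (inner j z).edist v v' := by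
  refine le_iInf fun p => ?_
  let f : (inner j z) →g S.glue inner := ⟨fun v => (j, z, .inl v), fun h => glue_adj_inner h⟩
  have := (SimpleGraph.edist_le (p.map f))
  rwa [SimpleGraph.Walk.length_map] at this

lemma edist_le_one_of_rel {x y : ℕ × A × (V ⊕ K × ℕ)} (h : S.Rel inner x y) :
    (S.glue inner).edist x y ≤ 1 := by
  rcases eq_or_ne x y with rfl | hne
  · simp
  · exact (SimpleGraph.edist_eq_one_iff_adj.2 (by
      rw [glue, SimpleGraph.fromRel_adj]; exact ⟨hne, .inl h⟩)).le

lemma edist_glue_path_le {j : ℕ} (hj : j < S.m) (z : A) {c : K} (hc : S.valid j c) :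
    (S.glue inner).edist (j, z, .inl (S.src j c)) (j + 1, z + S.dir c, .inl (S.tgt j c)) ≤ S.s := by
  have : ∀ q, q ≤ S.s → (S.glue inner).edist (S.pt j z c 0) (S.pt j z c q) ≤ q := by
    intro q
    induction q with
    | zero => simp
    | succ q ih =>
      intro hq
      refine (SimpleGraph.edist_triangle (v := S.pt j z c q)).trans ?_
      push_cast
      gcongr
      · exact ih (by omega)
      · exact edist_le_one_of_rel (.path j z c q hj hc hq)
  have h := this S.s le_rfl
  rwa [pt_zero, pt_s] at h

/-- A cycle through an inner edge either stays in its copy or runs through a whole connecting path,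
and a cycle through an edge of a connecting path contains the whole path; these paths have length at
least `g + 1`. -/
lemma edgeSeparated_glue {g : ℕ} (hg : g + 1 ≤ S.s) (hin : ∀ j z, EdgeSeparated g (inner j z)) :
    EdgeSeparated g (S.glue inner) := by
  classical
  have key : ∀ x y, S.Rel inner x y → ∃ h : ℕ × A × (V ⊕ K × ℕ) → ℤ,
      IsPotential ((S.glue inner).deleteEdges {s(x, y)}) h ∧ h x + g ≤ h y := by
    rintro x y (⟨j, z, v, v', hv⟩ | ⟨j, z, c, q, hj, hc, hq⟩)
    · obtain ⟨h, hh, hvv⟩ := hin j z v v' hv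
      -- The deletion is moved into the inner graph, so that the extension lemma applies. The
      -- separating potential is clamped to a range of width `g` and is constant on all other
      -- copies; the connecting paths are long enough to absorb the difference.
      let inner' : ℕ → A → SimpleGraph V := fun j' z' =>
        if j' = j ∧ z' = z then (inner j z).deleteEdges {s(v, v')} else inner j' z'
      let h₀ : ℕ → A → V → ℤ := fun j' z' u =>
        if j' = j ∧ z' = z then min (max (h u) (h v)) (h v + g) else h v
      have hr : ∀ j' z' u, h v ≤ h₀ j' z' u ∧ h₀ j' z' u ≤ h v + g := by
        intro j' z' u
        simp only [h₀]
        split_ifs <;> omega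
      obtain ⟨k, hk, hk0⟩ := exists_isPotential_glue (S := S) (inner := inner') h₀ (by
          intro j' z'
          simp only [inner', h₀]
          split_ifs with hjz
          · exact hh.clamp _ _
          · exact IsPotential.const _ _) (by
          intro j' hj' z' c hc
          have h1 := hr j' z' (S.src j' c)
          have h2 := hr (j' + 1) (z' + S.dir c) (S.tgt j' c)
          omega)
      refine ⟨k, hk.mono ?_, ?_⟩
      · intro a b hab
        rw [SimpleGraph.deleteEdges_adj, glue, SimpleGraph.fromRel_adj] at hab
        obtain ⟨⟨hne, hr⟩, he⟩ := hab
        have aux : ∀ a b, S.Rel inner a b → s(a, b) ≠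
            s(((j, z, .inl v) : ℕ × A × (V ⊕ K × ℕ)), (j, z, .inl v')) → S.Rel inner' a b := by
          rintro a b (⟨j', z', u, u', hu⟩ | ⟨j', z', c, q, hj, hc, hq⟩) hab
          · refine .inner _ _ _ _ ?_
            simp only [inner']
            split_ifs with hjz
            · obtain ⟨rfl, rfl⟩ := hjz
              rw [SimpleGraph.deleteEdges_adj]
              refine ⟨hu, fun he => hab ?_⟩
              rw [Set.mem_singleton_iff] at he
              have := congrArg (Sym2.map
                (fun v => ((j', z', .inl v) : ℕ × A × (V ⊕ K × ℕ)))) he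
              simpa using this
            · exact hu
          · exact .path _ _ _ _ hj hc hq
        rw [glue, SimpleGraph.fromRel_adj]
        refine ⟨hne, hr.imp (fun h => aux _ _ h ?_) (fun h => aux _ _ h ?_)⟩
        · simpa using he
        · rw [Sym2.eq_swap]; simpa using he
      · rw [hk0, hk0]
        simp only [h₀]
        simp only [and_self, if_true]
        omega
    -- Along the path the potential falls from 0 to `-q`, jumps by `s - 1 ≥ g` across the deleted
    -- edge, and falls back to 0 at the far end. Hence it vanishes on everything else.
    · let F : ℕ → ℤ := fun q' => if q' ≤ q then -q' else (S.s - q' : ℤ)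
      let h : ℕ × A × (V ⊕ K × ℕ) → ℤ := fun x =>
        Sum.elim (fun _ => 0) (fun cq => if x.1 = j ∧ x.2.1 = z ∧ cq.1 = c then F cq.2 else 0) x.2.2
      have hpt : ∀ q', q' ≤ S.s → h (S.pt j z c q') = F q' := by
        intro q' hq'
        have hs := S.s_pos
        rcases Nat.eq_zero_or_pos q' with rfl | hq0
        · rw [pt_zero]; simp [h, F]
        · rcases hq'.lt_or_eq with hq' | rfl
          · simp [pt, hq0.ne', hq', h]
          · rw [pt_s]; simp [h, F]; omega
      have hpt' : ∀ j' z' c' q', ¬ (j' = j ∧ z' = z ∧ c' = c) → h (S.pt j' z' c' q') = 0 := by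
        intro j' z' c' q' hne
        unfold pt
        split_ifs
        · rfl
        · simp only [h, Sum.elim_inr]; rw [if_neg hne]
        · rfl
      refine ⟨h, ?_, ?_⟩
      · have aux : ∀ a b, S.Rel inner a b → s(a, b) ≠ s(S.pt j z c q, S.pt j z c (q + 1)) →
            h b ≤ h a + 1 ∧ h a ≤ h b + 1 := by
          rintro a b (⟨j', z', u, u', hu⟩ | ⟨j', z', c', q', hj', hc', hq'⟩) hab
          · simp [h]
          · by_cases hjz : j' = j ∧ z' = z ∧ c' = c
            · obtain ⟨rfl, rfl, rfl⟩ := hjz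
              have hqq : q' ≠ q := by rintro rfl; exact hab rfl
              rw [hpt _ hq'.le, hpt _ hq']
              simp only [F]
              split_ifs <;> push_cast <;> omega
            · rw [hpt' _ _ _ _ hjz, hpt' _ _ _ _ hjz]; omega
        intro a b hab
        rw [SimpleGraph.deleteEdges_adj, glue, SimpleGraph.fromRel_adj] at hab
        obtain ⟨⟨hne, hr | hr⟩, he⟩ := hab
        · exact (aux _ _ hr (by simpa using he)).1
        · exact (aux _ _ hr (by rw [Sym2.eq_swap]; simpa using he)).2
      · rw [hpt q hq.le, hpt (q + 1) hq]
        simp only [F]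
        simp
        omega
  intro x y hxy
  rw [glue, SimpleGraph.fromRel_adj] at hxy
  rcases hxy.2 with h1 | h1
  · exact key x y h1
  · obtain ⟨h, hh, h2⟩ := key y x h1
    rw [Sym2.eq_swap] at hh
    exact ⟨fun v => -h v, hh.neg, by dsimp only; omega⟩

end LayeredScheme

/-! ### Gadgets and rigidity of label sequences -/

/-- A family of graphs of girth more than `g`, indexed by the sets `T` of blocked pairs of ports.
Every left port has distance at least `C` from every right port; the distance of a pair in `pairs`
is at most `D` if the pair is not blocked, and at least `C + Y` if it is. -/
structure Gadget (g C D Y : ℕ) (V I J : Type) where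
  supp : Finset V
  left : I → V
  right : J → V
  pairs : Finset (I × J)
  graph : Set (I × J) → SimpleGraph V
  left_mem : ∀ a, left a ∈ supp
  right_mem : ∀ b, right b ∈ supp
  adj_mem : ∀ T x y, (graph T).Adj x y → x ∈ supp
  girth : ∀ T, EdgeSeparated g (graph T)
  short : ∀ T, ∀ p ∈ pairs, p ∉ T → (graph T).edist (left p.1) (right p.2) ≤ D
  cross : ∀ T, ∃ h : V → ℤ, IsPotential (graph T) h ∧ (∀ a, h (left a) = 0) ∧
    ∀ b, h (right b) = C
  block : ∀ T, ∀ p ∈ pairs, p ∈ T → ∃ h : V → ℤ, IsPotential (graph T) h ∧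
    (∀ v, 0 ≤ h v ∧ h v ≤ C + Y) ∧ h (left p.1) = 0 ∧ h (right p.2) = C + Y ∧
    (∀ a, h (left a) ≤ Y) ∧ ∀ b, C ≤ h (right b)

/-- `t` labels (on either side) add up to a constant sequence only if they are constant. -/
def SumRigid {I J A : Type} [AddCommGroup A] (t : ℕ) (dir : I ⊕ J → A) : Prop :=
  ∀ (a : ℕ → I) (b : ℕ → J) (a₀ : I) (b₀ : J),
    ∑ i ∈ Finset.range t, dir (.inl (a i)) + ∑ i ∈ Finset.range t, dir (.inr (b i)) =
      t • dir (.inl a₀) + t • dir (.inr b₀) → ∀ i < t, a i = a₀ ∧ b i = b₀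

section Labels

variable {I J A : Type} [AddCommGroup A]

/-- The labels that are used in step `j`: left ones in even steps, right ones in odd steps. -/
def LabelValid (j : ℕ) : I ⊕ J → Prop
  | .inl _ => Even j
  | .inr _ => ¬ Even j

/-- The alternating label sequence of a pair. -/
def altLabel (p : I × J) (j : ℕ) : I ⊕ J := if Even j then .inl p.1 else .inr p.2

/-- The displacement along the alternating label sequence of a pair after `j` steps. -/
def altSum (dir : I ⊕ J → A) (p : I × J) (j : ℕ) : A := ∑ i ∈ Finset.range j, dir (altLabel p i)

lemma labelValid_altLabel (p : I × J) (j : ℕ) : LabelValid j (altLabel p j) := by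
  unfold altLabel
  split_ifs with h
  · exact h
  · exact h

lemma altSum_succ (dir : I ⊕ J → A) (p : I × J) (j : ℕ) :
    altSum dir p (j + 1) = altSum dir p j + dir (altLabel p j) :=
  Finset.sum_range_succ _ _

lemma sum_range_two_mul' (f : ℕ → A) (t : ℕ) : ∑ i ∈ Finset.range (2 * t), f i =
    ∑ i ∈ Finset.range t, f (2 * i) + ∑ i ∈ Finset.range t, f (2 * i + 1) := by
  induction t with
  | zero => simp
  | succ t ih =>
    rw [show 2 * (t + 1) = 2 * t + 1 + 1 by ring, Finset.sum_range_succ, Finset.sum_range_succ, ih,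
      Finset.sum_range_succ, Finset.sum_range_succ]
    abel

lemma altSum_two_mul (dir : I ⊕ J → A) (p : I × J) (t : ℕ) :
    altSum dir p (2 * t) = t • dir (.inl p.1) + t • dir (.inr p.2) := by
  rw [altSum, sum_range_two_mul']
  simp [altLabel]

lemma SumRigid.eq_altLabel {t : ℕ} {dir : I ⊕ J → A} (hdir : SumRigid t dir) {c : ℕ → I ⊕ J}
    (hc : ∀ i < 2 * t, LabelValid i (c i)) {p : I × J}
    (hsum : ∑ i ∈ Finset.range (2 * t), dir (c i) = altSum dir p (2 * t)) :
    ∀ i < 2 * t, c i = altLabel p i := by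
  have ha : ∀ i, ∃ a, i < t → c (2 * i) = .inl a := by
    intro i
    by_cases hi : i < t
    · have := hc (2 * i) (by omega)
      rcases h : c (2 * i) with a | b
      · exact ⟨a, fun _ => rfl⟩
      · rw [h] at this; simp [LabelValid] at this
    · exact ⟨p.1, fun h => absurd h hi⟩
  have hb : ∀ i, ∃ b, i < t → c (2 * i + 1) = .inr b := by
    intro i
    by_cases hi : i < t
    · have := hc (2 * i + 1) (by omega)
      rcases h : c (2 * i + 1) with a | b
      · rw [h] at this; simp [LabelValid] at this
      · exact ⟨b, fun _ => rfl⟩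
    · exact ⟨p.2, fun h => absurd h hi⟩
  choose a ha using ha
  choose b hb using hb
  rw [sum_range_two_mul', altSum_two_mul] at hsum
  have h1 : ∑ i ∈ Finset.range t, dir (c (2 * i)) = ∑ i ∈ Finset.range t, dir (.inl (a i)) :=
    Finset.sum_congr rfl fun i hi => by rw [ha i (Finset.mem_range.1 hi)]
  have h2 : ∑ i ∈ Finset.range t, dir (c (2 * i + 1)) = ∑ i ∈ Finset.range t, dir (.inr (b i)) :=
    Finset.sum_congr rfl fun i hi => by rw [hb i (Finset.mem_range.1 hi)]
  rw [h1, h2] at hsum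
  have key := hdir a b p.1 p.2 hsum
  intro i hi
  rcases Nat.even_or_odd' i with ⟨j, rfl | rfl⟩
  · rw [ha j (by omega), (key j (by omega)).1]; simp [altLabel]
  · rw [hb j (by omega), (key j (by omega)).2]; simp [altLabel]

/-- `z` can be reached from `z₀` in the first `j` steps. -/
def ReachedFrom (dir : I ⊕ J → A) (z₀ : A) (j : ℕ) (z : A) : Prop :=
  ∃ c : ℕ → I ⊕ J, (∀ i < j, LabelValid i (c i)) ∧ z = z₀ + ∑ i ∈ Finset.range j, dir (c i)

/-- `z₁` can be reached from `z` in the steps `j, …, m - 1`. -/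
def Reaches (dir : I ⊕ J → A) (m : ℕ) (z₁ : A) (j : ℕ) (z : A) : Prop :=
  ∃ c : ℕ → I ⊕ J, (∀ i, j ≤ i → i < m → LabelValid i (c i)) ∧
    z₁ = z + ∑ i ∈ Finset.Ico j m, dir (c i)

lemma reachedFrom_zero (dir : I ⊕ J → A) [Nonempty (I ⊕ J)] (z₀ z : A) :
    ReachedFrom dir z₀ 0 z ↔ z = z₀ := by
  simp [ReachedFrom]

lemma ReachedFrom.succ {dir : I ⊕ J → A} {z₀ z : A} {j : ℕ} (h : ReachedFrom dir z₀ j z)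
    {c : I ⊕ J} (hc : LabelValid j c) : ReachedFrom dir z₀ (j + 1) (z + dir c) := by
  obtain ⟨f, hf, rfl⟩ := h
  refine ⟨fun i => if i < j then f i else c, fun i hi => ?_, ?_⟩
  · dsimp only
    split_ifs with hij
    · exact hf i hij
    · rwa [show i = j by omega]
  · rw [Finset.sum_range_succ]
    dsimp only
    rw [if_neg (lt_irrefl _), add_assoc]
    congr 2
    exact Finset.sum_congr rfl fun i hi => by rw [if_pos (Finset.mem_range.1 hi)]

lemma Reaches.pred {dir : I ⊕ J → A} {z₁ z : A} {j m : ℕ} (hj : j < m) {c : I ⊕ J}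
    (hc : LabelValid j c) (h : Reaches dir m z₁ (j + 1) (z + dir c)) : Reaches dir m z₁ j z := by
  obtain ⟨f, hf, hz⟩ := h
  refine ⟨fun i => if i = j then c else f i, fun i hi hi' => ?_, ?_⟩
  · dsimp only
    split_ifs with hij
    · rwa [hij]
    · exact hf i (by omega) hi'
  · rw [Finset.sum_eq_sum_Ico_succ_bot hj]
    dsimp only
    rw [if_pos rfl, hz, add_assoc]
    congr 2
    refine Finset.sum_congr rfl fun i hi => ?_
    rw [if_neg]
    have := (Finset.mem_Ico.1 hi).1
    omega

/-- A route from `z₀` to `z` followed by one from `z` to the endpoint is a full label sequence with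
the prescribed sum. Rigidity makes it the alternating one. -/
lemma SumRigid.eq_of_reaches {t : ℕ} {dir : I ⊕ J → A} (hdir : SumRigid t dir) {z₀ z : A}
    {p : I × J} {j : ℕ} (hj : j ≤ 2 * t) (hF : ReachedFrom dir z₀ j z)
    (hB : Reaches dir (2 * t) (z₀ + altSum dir p (2 * t)) j z) : z = z₀ + altSum dir p j := by
  obtain ⟨f, hf, rfl⟩ := hF
  obtain ⟨f', hf', h⟩ := hB
  have key := hdir.eq_altLabel (c := fun i => if i < j then f i else f' i) (p := p) (by
    intro i hi
    split_ifs with hij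
    · exact hf i hij
    · exact hf' i (by omega) hi) (by
    rw [add_assoc] at h
    rw [add_left_cancel h, ← Finset.sum_range_add_sum_Ico _ hj]
    congr 1
    · exact Finset.sum_congr rfl fun i hi => by rw [if_pos (Finset.mem_range.1 hi)]
    · refine Finset.sum_congr rfl fun i hi => ?_
      rw [if_neg (by have := (Finset.mem_Ico.1 hi).1; omega)])
  rw [altSum]
  congr 1
  refine Finset.sum_congr rfl fun i hi => ?_
  have := Finset.mem_range.1 hi
  have h1 := key i (by omega)
  rw [if_pos this] at h1
  rw [h1]

lemma SumRigid.label_eq_of_reaches {t : ℕ} {dir : I ⊕ J → A} (hdir : SumRigid t dir) {z₀ z : A}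
    {p : I × J} {j : ℕ} (hj : j < 2 * t) (hF : ReachedFrom dir z₀ j z) {c : I ⊕ J}
    (hc : LabelValid j c)
    (hB : Reaches dir (2 * t) (z₀ + altSum dir p (2 * t)) (j + 1) (z + dir c)) :
    c = altLabel p j := by
  obtain ⟨f, hf, rfl⟩ := hF
  obtain ⟨f', hf', h⟩ := hB
  have key := hdir.eq_altLabel
    (c := fun i => if i < j then f i else if i = j then c else f' i) (p := p) (by
    intro i hi
    split_ifs with hij hij'
    · exact hf i hij
    · rwa [hij']
    · exact hf' i (by omega) hi) (by
    rw [add_assoc, add_assoc] at h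
    rw [add_left_cancel h, ← Finset.sum_range_add_sum_Ico _ hj.le,
      Finset.sum_eq_sum_Ico_succ_bot hj, if_neg (lt_irrefl _), if_pos rfl]
    congr 1
    · exact Finset.sum_congr rfl fun i hi => by rw [if_pos (Finset.mem_range.1 hi)]
    · congr 1
      refine Finset.sum_congr rfl fun i hi => ?_
      have := (Finset.mem_Ico.1 hi).1
      rw [if_neg (by omega), if_neg (by omega)])
  simpa using key j hj

end Labels

/-! ### Composition of gadgets -/

namespace Gadget

variable {g C D Y : ℕ} {V I J A : Type} [AddCommGroup A] (G : Gadget g C D Y V I J)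

/-- The port with a given label. -/
def port : I ⊕ J → V := Sum.elim G.left G.right

lemma port_mem (c : I ⊕ J) : G.port c ∈ G.supp := by
  rcases c with a | b
  · exact G.left_mem a
  · exact G.right_mem b

/-- Labels alternate between the sides, so layer `j + 1` is crossed from left to right for even `j`
and from right to left for odd `j`. In the second case the potential is reflected. -/
lemma exists_cross_port (T : Set (I × J)) (j : ℕ) : ∃ h : V → ℤ, IsPotential (G.graph T) h ∧
    (∀ c, LabelValid j c → h (G.port c) = 0) ∧ ∀ c, LabelValid (j + 1) c → h (G.port c) = C := by
  obtain ⟨h, hh, h1, h2⟩ := G.cross T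
  rcases Nat.even_or_odd j with hj | hj
  · refine ⟨h, hh, ?_, ?_⟩ <;> rintro (a | b) hc
    · exact h1 a
    · exact absurd hj hc
    · exact absurd hj (Nat.even_add_one.1 hc)
    · exact h2 b
  · rw [← Nat.not_even_iff_odd] at hj
    refine ⟨fun v => C - h v, hh.const_sub _, ?_, ?_⟩ <;> rintro (a | b) hc
    · exact absurd hc hj
    · simp [port, h2]
    · simp [port, h1]
    · exact absurd (Nat.even_add_one.2 hj) hc

lemma exists_block_port {T : Set (I × J)} {p : I × J} (hp : p ∈ G.pairs) (hT : p ∈ T) (j : ℕ) :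
    ∃ h : V → ℤ, IsPotential (G.graph T) h ∧
    (∀ c, LabelValid j c → 0 ≤ h (G.port c) ∧ h (G.port c) ≤ Y) ∧
    h (G.port (altLabel p j)) = 0 ∧
    (∀ c, LabelValid (j + 1) c → C ≤ h (G.port c) ∧ h (G.port c) ≤ C + Y) ∧
    h (G.port (altLabel p (j + 1))) = C + Y := by
  obtain ⟨h, hh, h0, h1, h2, h3, h4⟩ := G.block T p hp hT
  rcases Nat.even_or_odd j with hj | hj
  · have hj' : ¬ Even (j + 1) := by rw [Nat.even_add_one]; simpa using hj
    refine ⟨h, hh, ?_, ?_, ?_, ?_⟩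
    · rintro (a | b) hc
      · exact ⟨(h0 _).1, h3 a⟩
      · exact absurd hj hc
    · simpa [altLabel, hj, port] using h1
    · rintro (a | b) hc
      · exact absurd hc hj'
      · exact ⟨h4 b, (h0 _).2⟩
    · simp only [altLabel, hj', port, if_false, Sum.elim_inr]; exact h2
  · rw [← Nat.not_even_iff_odd] at hj
    have hj' : Even (j + 1) := Nat.even_add_one.2 hj
    refine ⟨fun v => C + Y - h v, hh.const_sub _, ?_, ?_, ?_, ?_⟩
    · rintro (a | b) hc
      · exact absurd hc hj
      · have := h0 (G.right b); have := h4 b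
        simp only [port, Sum.elim_inr]; omega
    · simp only [altLabel, hj, port, if_false, Sum.elim_inr]; omega
    · rintro (a | b) hc
      · have := h0 (G.left a); have := h3 a
        simp only [port, Sum.elim_inl]; omega
      · exact absurd hj' hc
    · simp only [altLabel, hj', port, if_true, Sum.elim_inl]; omega

/-- The scheme by which copies of a gadget are composed; the first and the last layer consist of
single vertices. -/
def scheme (dir : I ⊕ J → A) (w s : ℕ) (hs : 0 < s) (v₀ : V) : LayeredScheme A V (I ⊕ J) where
  m := w + 1
  s := s
  s_pos := hs
  valid := LabelValid
  dir := dir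
  src j c := if j = 0 then v₀ else G.port c
  tgt j c := if j = w then v₀ else G.port c

/-- The pairs that are blocked in the copy at `z` in layer `j`. -/
def blockedAt (dir : I ⊕ J → A) (w : ℕ) (T : Set (A × A)) (j : ℕ) (z : A) : Set (I × J) :=
  {p | (z - altSum dir p j, z - altSum dir p j + altSum dir p (w + 1)) ∈ T}

/-- The copy of the gadget at `z` in layer `j`. -/
def innerGraph (dir : I ⊕ J → A) (w : ℕ) (T : Set (A × A)) (j : ℕ) (z : A) : SimpleGraph V :=
  if 0 < j ∧ j ≤ w then G.graph (blockedAt dir w T j z) else ⊥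

variable {G} {dir : I ⊕ J → A} {w s : ℕ} {hs : 0 < s} {v₀ : V} {T : Set (A × A)}

/-- The alternating route visits the copies at `z₀ + altSum dir p j`, and `blockedAt` traces each of
them back to the same outer pair. If that pair is not in `T`, then `p` is open in all of them. -/
lemma edist_compose_le {z₀ : A} {p : I × J} (hp : p ∈ G.pairs)
    (hT : (z₀, z₀ + altSum dir p (w + 1)) ∉ T) (j : ℕ) (hj : j ≤ w) :
    ((G.scheme dir w s hs v₀).glue (G.innerGraph dir w T)).edist (0, z₀, .inl v₀)
      (j + 1, z₀ + altSum dir p (j + 1), .inl ((G.scheme dir w s hs v₀).tgt j (altLabel p j))) ≤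
      ((j * D + (j + 1) * s : ℕ) : ℕ∞) := by
  induction j with
  | zero =>
    have := LayeredScheme.edist_glue_path_le (S := G.scheme dir w s hs v₀)
      (inner := G.innerGraph dir w T) (j := 0) (c := altLabel p 0) (Nat.succ_pos _) z₀
      (labelValid_altLabel p 0)
    simpa [scheme, altSum] using this
  | succ j ih =>
    have h1 := ih (by omega)
    have h2 := LayeredScheme.edist_glue_path_le (S := G.scheme dir w s hs v₀)
      (inner := G.innerGraph dir w T) (j := j + 1) (by simp [scheme]; omega)
      (c := altLabel p (j + 1)) (z₀ + altSum dir p (j + 1)) (labelValid_altLabel p (j + 1))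
    have h3 := LayeredScheme.edist_glue_inner_le (S := G.scheme dir w s hs v₀)
      (inner := G.innerGraph dir w T) (j + 1) (z₀ + altSum dir p (j + 1))
      ((G.scheme dir w s hs v₀).tgt j (altLabel p j))
      ((G.scheme dir w s hs v₀).src (j + 1) (altLabel p (j + 1)))
    have h4 : (G.innerGraph dir w T (j + 1) (z₀ + altSum dir p (j + 1))).edist
        ((G.scheme dir w s hs v₀).tgt j (altLabel p j))
        ((G.scheme dir w s hs v₀).src (j + 1) (altLabel p (j + 1))) ≤ D := by
      have h5 := G.short (blockedAt dir w T (j + 1) (z₀ + altSum dir p (j + 1))) p hp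
        (by simpa [blockedAt] using hT)
      have hjw : j ≠ w := by omega
      rw [innerGraph, if_pos (by omega)]
      simp only [scheme, if_neg hjw, if_neg (Nat.succ_ne_zero j)]
      rcases Nat.even_or_odd j with hj | hj
      · have hj' : ¬ Even (j + 1) := by rw [Nat.even_add_one]; simpa using hj
        simpa [altLabel, hj, hj', port] using h5
      · rw [← Nat.not_even_iff_odd] at hj
        rw [SimpleGraph.edist_comm] at h5
        simpa [altLabel, hj, Nat.even_add_one.2 hj, port] using h5
    rw [altSum_succ dir p (j + 1), ← add_assoc]
    calc _ ≤ _ := SimpleGraph.edist_triangle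
      _ ≤ _ := add_le_add_left SimpleGraph.edist_triangle _
      _ ≤ _ := add_le_add (add_le_add h1 (h3.trans h4)) h2
      _ = _ := by
        simp only [scheme]
        push_cast
        ring

/-- Every layer adds `C` and every step adds `s`, independently of the labels, as the crossing
potentials are constant on each side. -/
lemma exists_cross_compose (T : Set (A × A)) :
    ∃ h : ℕ × A × (V ⊕ (I ⊕ J) × ℕ) → ℤ,
      IsPotential ((G.scheme dir w s hs v₀).glue (G.innerGraph dir w T)) h ∧
      (∀ z, h (0, z, .inl v₀) = 0) ∧
      ∀ z, h (w + 1, z, .inl v₀) = ((w * C + (w + 1) * s : ℕ) : ℤ) := by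
  choose φ hφ hin hout using fun T j => G.exists_cross_port T j
  let h₀ : ℕ → A → V → ℤ := fun j z v => if j = 0 then 0 else
    if j = w + 1 then w * C + (w + 1) * s else
      (j - 1) * C + j * s + φ (blockedAt dir w T j z) (j - 1) v
  have hmid : ∀ j z, j + 1 ≤ w → h₀ (j + 1) z = fun v =>
      j * C + (j + 1) * s + φ (blockedAt dir w T (j + 1) z) j v := by
    intro j z hj'
    funext v
    simp only [h₀]
    rw [if_neg (by omega), if_neg (by omega), Nat.add_sub_cancel]
    push_cast
    rw [add_sub_cancel_right]
  have hlast : ∀ z v, h₀ (w + 1) z v = w * C + (w + 1) * s := by simp [h₀]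
  obtain ⟨h, hh, hh0⟩ := LayeredScheme.exists_isPotential_glue (S := G.scheme dir w s hs v₀)
    (inner := G.innerGraph dir w T) h₀ (by
      intro j z
      unfold innerGraph
      by_cases hj : 0 < j ∧ j ≤ w
      · obtain ⟨j, rfl⟩ : ∃ i, j = i + 1 := ⟨j - 1, by omega⟩
        rw [if_pos hj, hmid j z hj.2]
        intro u v huv
        have := hφ _ j u v huv
        linarith
      · rw [if_neg hj]
        intro u v huv
        exact absurd huv (by simp)) (by
      intro j hj z c hc
      have hj : j ≤ w := Nat.lt_succ_iff.1 hj
      change LabelValid j c at hc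
      change h₀ (j + 1) (z + dir c) (if j = w then v₀ else G.port c) ≤
          h₀ j z (if j = 0 then v₀ else G.port c) + (s : ℤ) ∧
        h₀ j z (if j = 0 then v₀ else G.port c) ≤
          h₀ (j + 1) (z + dir c) (if j = w then v₀ else G.port c) + (s : ℤ)
      have h1 : h₀ (j + 1) (z + dir c) (if j = w then v₀ else G.port c) =
          j * C + (j + 1) * s := by
        rcases hj.lt_or_eq with hj | rfl
        · rw [hmid _ _ hj, if_neg hj.ne]
          beta_reduce
          rw [hin _ _ _ hc, add_zero]
        · rw [hlast]
      have h2 : h₀ j z (if j = 0 then v₀ else G.port c) = j * C + j * s := by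
        rcases Nat.eq_zero_or_pos j with rfl | hj0
        · simp [h₀]
        · obtain ⟨j, rfl⟩ : ∃ i, j = i + 1 := ⟨j - 1, by omega⟩
          rw [hmid _ _ hj, if_neg (by omega)]
          beta_reduce
          rw [hout _ _ _ hc]
          push_cast
          ring
      rw [h1, h2]
      constructor <;> linarith)
  refine ⟨h, hh, fun z => ?_, fun z => ?_⟩
  · rw [hh0]; simp [h₀]
  · rw [hh0]; simp [h₀]

/-- The potential is the crossing potential plus an excess between 0 and `w * Y`. Forward moves
never increase the excess except inside the blocked copies on the alternating route, each of which
adds `Y`. Backward moves may raise it by as much as `w * Y ≤ 2 * s`, which the connecting path pays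
for. -/
lemma exists_block_compose [Nonempty (I ⊕ J)] {t : ℕ} (ht : w + 1 = 2 * t)
    (hdir : SumRigid t dir) (hY : w * Y ≤ 2 * s) {z₀ : A} {p : I × J} (hp : p ∈ G.pairs)
    (hT : (z₀, z₀ + altSum dir p (w + 1)) ∈ T) :
    ∃ h : ℕ × A × (V ⊕ (I ⊕ J) × ℕ) → ℤ,
      IsPotential ((G.scheme dir w s hs v₀).glue (G.innerGraph dir w T)) h ∧
      h (0, z₀, .inl v₀) = 0 ∧
      h (w + 1, z₀ + altSum dir p (w + 1), .inl v₀) =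
        ((w * C + (w + 1) * s : ℕ) : ℤ) + ((w * Y : ℕ) : ℤ) ∧
      (∀ z, 0 ≤ h (0, z, .inl v₀) ∧ h (0, z, .inl v₀) ≤ ((w * Y : ℕ) : ℤ)) ∧
      ∀ z, ((w * C + (w + 1) * s : ℕ) : ℤ) ≤ h (w + 1, z, .inl v₀) := by
  classical
  choose φ hφ hin hout using fun T j => G.exists_cross_port T j
  have hblock : ∀ T j, ∃ h : V → ℤ, p ∈ T → IsPotential (G.graph T) h ∧
    (∀ c, LabelValid j c → 0 ≤ h (G.port c) ∧ h (G.port c) ≤ Y) ∧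
    h (G.port (altLabel p j)) = 0 ∧
    (∀ c, LabelValid (j + 1) c → C ≤ h (G.port c) ∧ h (G.port c) ≤ C + Y) ∧
    h (G.port (altLabel p (j + 1))) = C + Y := by
    intro T j
    by_cases hT : p ∈ T
    · obtain ⟨h, hh⟩ := G.exists_block_port hp hT j
      exact ⟨h, fun _ => hh⟩
    · exact ⟨0, fun h => absurd h hT⟩
  choose ψ hψ using hblock
  set z₁ := z₀ + altSum dir p (w + 1) with hz₁
  let F : ℕ → A → Prop := ReachedFrom dir z₀
  let B : ℕ → A → Prop := Reaches dir (w + 1) z₁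
  have hcan : ∀ j z, j ≤ w + 1 → F j z → B j z → z = z₀ + altSum dir p j := by
    intro j z hj hF hB
    simp only [B, F, hz₁, ht] at hF hB hj
    exact hdir.eq_of_reaches hj hF hB
  -- By rigidity a copy that lies on some forward route from `z₀` to `z₁` lies on the alternating
  -- route, where `p` is blocked.
  have hmem : ∀ j z, j ≤ w + 1 → F j z → B j z → p ∈ blockedAt dir w T j z := by
    intro j z hj hF hB
    have := hcan j z hj hF hB
    simpa [blockedAt, this] using hT
  have hF0 : F 0 z₀ := (reachedFrom_zero dir _ _).2 rfl
  have hF1 : F (w + 1) z₁ := ⟨altLabel p, fun i _ => labelValid_altLabel p i, rfl⟩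
  have hB1 : B (w + 1) z₁ := ⟨altLabel p, fun i _ _ => labelValid_altLabel p i, by simp⟩
  obtain ⟨W, hW⟩ : ∃ W : ℤ, W = w * Y := ⟨_, rfl⟩
  have h0 : 0 ≤ W := by rw [hW]; positivity
  -- The excess is maximal where `z₀` does not lead, 0 where `z₀` leads but `z₁` can no longer be
  -- reached, and it grows by `Y` per layer on the route in between.
  let h₀ : ℕ → A → V → ℤ := fun j z v =>
    if j = 0 then (if F 0 z then 0 else W) else
    if j = w + 1 then w * C + (w + 1) * s + (if F j z ∧ ¬ B j z then 0 else W) else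
      (j - 1) * C + j * s + (if F j z then
        if B j z then (j - 1) * Y + ψ (blockedAt dir w T j z) (j - 1) v
        else φ (blockedAt dir w T j z) (j - 1) v
      else W + φ (blockedAt dir w T j z) (j - 1) v)
  have hzero : ∀ z v, h₀ 0 z v = if F 0 z then 0 else W := by simp [h₀]
  have hlast : ∀ z v, h₀ (w + 1) z v =
      w * C + (w + 1) * s + (if F (w + 1) z ∧ ¬ B (w + 1) z then 0 else W) := by
    intro z v
    simp only [h₀]
    rw [if_neg (by omega), if_pos trivial]
  have hmid : ∀ j z, j + 1 ≤ w → h₀ (j + 1) z = fun v =>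
      j * C + (j + 1) * s + (if F (j + 1) z then
        if B (j + 1) z then j * Y + ψ (blockedAt dir w T (j + 1) z) j v
        else φ (blockedAt dir w T (j + 1) z) j v
      else W + φ (blockedAt dir w T (j + 1) z) j v) := by
    intro j z hj'
    funext v
    simp only [h₀]
    rw [if_neg (by omega), if_neg (by omega), Nat.add_sub_cancel]
    push_cast
    rw [add_sub_cancel_right]
  have hYj : ∀ j : ℕ, j ≤ w → (j * Y : ℤ) ≤ W := fun j hj => by rw [hW]; gcongr
  -- `hentry` and `hexit` isolate the excess `E` at the two ends of a connecting path, the first and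
  -- the last layer included.
  have hentry : ∀ j, j ≤ w → ∀ z c, LabelValid j c → ∃ E : ℤ,
      h₀ (j + 1) z (if j = w then v₀ else G.port c) = j * C + (j + 1) * s + E ∧
      0 ≤ E ∧ E ≤ W ∧ (¬ F (j + 1) z → E = W) ∧ (F (j + 1) z → ¬ B (j + 1) z → E = 0) ∧
      (F (j + 1) z → B (j + 1) z → c = altLabel p j → E = j * Y) := by
    intro j hj z c hc
    rcases hj.lt_or_eq with hj | rfl
    · rw [hmid j z hj, if_neg hj.ne]
      beta_reduce
      have h5 := hYj (j + 1) hj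
      have h6 : (0 : ℤ) ≤ j * Y := by positivity
      push_cast at h5
      by_cases hF : F (j + 1) z
      · by_cases hB : B (j + 1) z
        · obtain ⟨-, h1, h2, -, -⟩ := hψ _ j (hmem (j + 1) z (by omega) hF hB)
          have h3 := h1 c hc
          refine ⟨j * Y + ψ (blockedAt dir w T (j + 1) z) j (G.port c), ?_, ?_, ?_, ?_, ?_, ?_⟩
          · rw [if_pos hF, if_pos hB]
          · linarith
          · linarith
          · exact fun h => absurd hF h
          · exact fun _ h => absurd hB h
          · rintro - - rfl
            rw [h2, add_zero]
        · exact ⟨0, by rw [if_pos hF, if_neg hB, hin _ _ _ hc], le_rfl, h0,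
            fun h => absurd hF h, fun _ _ => rfl, fun _ h => absurd h hB⟩
      · exact ⟨W, by rw [if_neg hF, hin _ _ _ hc, add_zero], h0, le_rfl, fun _ => rfl,
          fun h => absurd h hF, fun h => absurd h hF⟩
    · rw [hlast]
      refine ⟨_, rfl, ?_, ?_, ?_, ?_, ?_⟩
      · split_ifs <;> omega
      · split_ifs <;> omega
      · intro h; rw [if_neg (by tauto)]
      · intro h h'; rw [if_pos (by tauto)]
      · intro h h' _; rw [if_neg (by tauto), hW]
  have hexit : ∀ j, j ≤ w → ∀ z c, LabelValid j c → ∃ E : ℤ,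
      h₀ j z (if j = 0 then v₀ else G.port c) = j * C + j * s + E ∧
      0 ≤ E ∧ E ≤ W ∧ (¬ F j z → E = W) ∧
      (F j z → B j z → c = altLabel p j → E = j * Y) := by
    intro j hj z c hc
    rcases Nat.eq_zero_or_pos j with rfl | hj0
    · refine ⟨if F 0 z then 0 else W, by simp [hzero], ?_, ?_, ?_, ?_⟩
      · split_ifs <;> omega
      · split_ifs <;> omega
      · intro h; rw [if_neg h]
      · intro h _ _; rw [if_pos h]; simp
    · obtain ⟨j, rfl⟩ : ∃ i, j = i + 1 := ⟨j - 1, by omega⟩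
      rw [hmid j z hj, if_neg (by omega)]
      beta_reduce
      have h5 := hYj (j + 1) hj
      have h6 : (0 : ℤ) ≤ j * Y := by positivity
      push_cast at h5 ⊢
      by_cases hF : F (j + 1) z
      · by_cases hB : B (j + 1) z
        · obtain ⟨-, -, -, h1, h2⟩ := hψ _ j (hmem (j + 1) z (by omega) hF hB)
          have h3 := h1 c hc
          refine ⟨j * Y + ψ (blockedAt dir w T (j + 1) z) j (G.port c) - C, ?_, ?_, ?_, ?_, ?_⟩
          · rw [if_pos hF, if_pos hB]; ring
          · linarith
          · linarith
          · exact fun h => absurd hF h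
          · rintro - - rfl
            rw [h2]
            ring
        · exact ⟨0, by rw [if_pos hF, if_neg hB, hout _ _ _ hc]; ring, le_rfl, h0,
            fun h => absurd hF h, fun _ h => absurd h hB⟩
      · exact ⟨W, by rw [if_neg hF, hout _ _ _ hc]; ring, h0, le_rfl, fun _ => rfl,
          fun h => absurd h hF⟩
  obtain ⟨h, hh, hh0⟩ := LayeredScheme.exists_isPotential_glue (S := G.scheme dir w s hs v₀)
    (inner := G.innerGraph dir w T) h₀ (by
      intro j z
      unfold innerGraph
      by_cases hj : 0 < j ∧ j ≤ w
      · obtain ⟨j, rfl⟩ : ∃ i, j = i + 1 := ⟨j - 1, by omega⟩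
        rw [if_pos hj, hmid j z hj.2]
        intro u v huv
        have h1 := hφ _ j u v huv
        by_cases hF : F (j + 1) z
        · by_cases hB : B (j + 1) z
          · have h2 := (hψ _ j (hmem (j + 1) z (by omega) hF hB)).1 u v huv
            simp only [if_pos hF, if_pos hB]
            linarith
          · simp only [if_pos hF, if_neg hB]
            linarith
        · simp only [if_neg hF]
          linarith
      · rw [if_neg hj]
        intro u v huv
        exact absurd huv (by simp)) (by
      intro j hj z c hc
      have hj : j ≤ w := Nat.lt_succ_iff.1 hj
      change LabelValid j c at hc
      change h₀ (j + 1) (z + dir c) (if j = w then v₀ else G.port c) ≤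
          h₀ j z (if j = 0 then v₀ else G.port c) + (s : ℤ) ∧
        h₀ j z (if j = 0 then v₀ else G.port c) ≤
          h₀ (j + 1) (z + dir c) (if j = w then v₀ else G.port c) + (s : ℤ)
      obtain ⟨E, hE, hE0, hE1, hEF, hEB, hEc⟩ := hentry j hj (z + dir c) c hc
      obtain ⟨E', hE', hE0', hE1', hEF', hEc'⟩ := hexit j hj z c hc
      rw [hE, hE']
      have h2s : W ≤ 2 * s := by rw [hW]; exact_mod_cast hY
      -- Starting points not reached from `z₀` have maximal excess. From a reached one, a step
      -- either leaves the routes to `z₁`, so that `E = 0`, or it follows the alternating route and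
      -- both values are `j * Y`.
      have hle : E ≤ E' := by
        by_cases hFz : F j z
        · have hFz' : F (j + 1) (z + dir c) := hFz.succ hc
          by_cases hBz' : B (j + 1) (z + dir c)
          · have hBz : B j z := Reaches.pred (by omega) hc hBz'
            have hcl : c = altLabel p j := by
              have h1 := hBz'
              simp only [B, hz₁, ht] at h1
              exact hdir.label_eq_of_reaches (by omega) hFz hc h1
            rw [hEc hFz' hBz' hcl, hEc' hFz hBz hcl]
          · rw [hEB hFz' hBz']; exact hE0'
        · rw [hEF' hFz]; exact hE1
      constructor <;> linarith)
  have hW' : ((w * Y : ℕ) : ℤ) = W := by rw [hW]; push_cast; rfl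
  rw [hW']
  refine ⟨h, hh, ?_, ?_, fun z => ?_, fun z => ?_⟩
  · rw [hh0, hzero, if_pos hF0]
  · rw [hh0, hlast, if_neg (by tauto)]
    push_cast
    ring
  · rw [hh0, hzero]
    split_ifs <;> omega
  · rw [hh0, hlast]
    push_cast
    split_ifs <;> linarith

variable (G dir w s hs v₀)

/-- The composition of the copies of a gadget along the scheme given by `dir`. -/
noncomputable def compose [Fintype A] [Fintype I] [Fintype J] [Nonempty (I ⊕ J)] {t : ℕ}
    (ht : w + 1 = 2 * t) (hdir : SumRigid t dir) (hY : w * Y ≤ 2 * s) (hg : g + 1 ≤ s)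
    (hv₀ : v₀ ∈ G.supp) :
    Gadget g (w * C + (w + 1) * s) (w * D + (w + 1) * s) (w * Y) (ℕ × A × (V ⊕ (I ⊕ J) × ℕ)) A A :=
  letI : DecidableEq A := Classical.decEq A
  { supp := Finset.range (w + 2) ×ˢ Finset.univ ×ˢ
      (G.supp.disjSum (Finset.univ ×ˢ Finset.range s))
    left := fun z => (0, z, .inl v₀)
    right := fun z => (w + 1, z, .inl v₀)
    pairs := (Finset.univ ×ˢ G.pairs).image fun zp => (zp.1, zp.1 + altSum dir zp.2 (w + 1))
    graph := fun T => (G.scheme dir w s hs v₀).glue (G.innerGraph dir w T)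
    left_mem := by simp [hv₀]
    right_mem := by simp [hv₀]
    adj_mem := by
      intro T x y hxy
      have hpt : ∀ j < w + 1, ∀ z c q, (G.scheme dir w s hs v₀).pt j z c q ∈
          (Finset.range (w + 2) ×ˢ (Finset.univ : Finset A) ×ˢ
            (G.supp.disjSum ((Finset.univ : Finset (I ⊕ J)) ×ˢ Finset.range s))) := by
        intro j hj z c q
        have := G.port_mem c
        rcases Nat.eq_zero_or_pos q with rfl | hq
        · rw [LayeredScheme.pt_zero]
          simp only [scheme]
          split_ifs <;> simp [hv₀, this] <;> omega
        · rcases lt_or_ge q s with hqs | hqs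
          · rw [LayeredScheme.pt_of_lt _ _ _ _ hq hqs]
            simp [hqs]
            omega
          · rw [LayeredScheme.pt_of_le _ _ _ _ hqs]
            simp only [scheme]
            split_ifs <;> simp [hv₀, this] <;> omega
      have aux : ∀ x y, (G.scheme dir w s hs v₀).Rel (G.innerGraph dir w T) x y →
          x ∈ (Finset.range (w + 2) ×ˢ (Finset.univ : Finset A) ×ˢ
            (G.supp.disjSum ((Finset.univ : Finset (I ⊕ J)) ×ˢ Finset.range s))) ∧
          y ∈ (Finset.range (w + 2) ×ˢ (Finset.univ : Finset A) ×ˢ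
            (G.supp.disjSum ((Finset.univ : Finset (I ⊕ J)) ×ˢ Finset.range s))) := by
        rintro x y (⟨j, z, v, v', h⟩ | ⟨j, z, c, q, hj, hc, hq⟩)
        · unfold innerGraph at h
          split_ifs at h with hj
          · have h1 := G.adj_mem _ _ _ h
            have h2 := G.adj_mem _ _ _ h.symm
            simp [h1, h2]
            omega
          · exact absurd h (by simp)
        · exact ⟨hpt j hj z c q, hpt j hj z c (q + 1)⟩
      rw [LayeredScheme.glue, SimpleGraph.fromRel_adj] at hxy
      rcases hxy.2 with h | h
      · exact (aux _ _ h).1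
      · exact (aux _ _ h).2
    girth := by
      intro T
      refine LayeredScheme.edgeSeparated_glue hg fun j z => ?_
      unfold innerGraph
      split_ifs
      · exact G.girth _
      · intro x y hxy
        exact absurd hxy (by simp)
    short := by
      intro T p hp hT
      obtain ⟨⟨z, p⟩, hzp, rfl⟩ := Finset.mem_image.1 hp
      have hp := (Finset.mem_product.1 hzp).2
      have := edist_compose_le (hs := hs) (v₀ := v₀) hp hT w le_rfl
      simpa [scheme] using this
    cross := by
      intro T
      obtain ⟨h, hh, h1, h2⟩ := exists_cross_compose (G := G) (dir := dir) (hs := hs) (v₀ := v₀) T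
      exact ⟨h, hh, h1, h2⟩
    block := by
      intro T p hp hT
      obtain ⟨⟨z, p⟩, hzp, rfl⟩ := Finset.mem_image.1 hp
      have hp := (Finset.mem_product.1 hzp).2
      obtain ⟨h, hh, h1, h2, h3, h4⟩ := exists_block_compose (G := G) (dir := dir) (hs := hs)
        (v₀ := v₀) ht hdir hY hp hT
      -- The potential is controlled only at the ports. Clamping adds the global bounds and keeps
      -- the values at the pair.
      refine ⟨_, hh.clamp 0 (((w * C + (w + 1) * s : ℕ) : ℤ) + ((w * Y : ℕ) : ℤ)), ?_, ?_, ?_,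
        ?_, ?_⟩
      · intro v; omega
      · dsimp only; rw [h1]; omega
      · dsimp only; rw [h2]; omega
      · intro a; have := h3 a; omega
      · intro b; have := h4 b; omega }

variable [Fintype A] [Fintype I] [Fintype J] [Nonempty (I ⊕ J)] {t : ℕ}
    (ht : w + 1 = 2 * t) (hdir : SumRigid t dir) (hY : w * Y ≤ 2 * s) (hg : g + 1 ≤ s)
    (hv₀ : v₀ ∈ G.supp)

lemma card_supp_compose : (G.compose dir w s hs v₀ ht hdir hY hg hv₀).supp.card =
    (w + 2) * (Fintype.card A * (G.supp.card + (Fintype.card I + Fintype.card J) * s)) := by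
  simp [compose]

/-- The endpoints determine `z` and the total displacement. Rigidity recovers the label sequence,
whose first two entries are the two components of `p`. -/
lemma card_pairs_compose : (G.compose dir w s hs v₀ ht hdir hY hg hv₀).pairs.card =
    Fintype.card A * G.pairs.card := by
  classical
  simp only [compose]
  rw [Finset.card_image_of_injective, Finset.card_product, Finset.card_univ]
  rintro ⟨z, p⟩ ⟨z', p'⟩ h
  simp only [Prod.mk.injEq] at h
  obtain ⟨rfl, h⟩ := h
  have h1 := add_left_cancel h
  have h2 := hdir.eq_altLabel (c := altLabel p) (fun i _ => labelValid_altLabel p i) (p := p')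
    (by rw [← ht]; exact h1)
  have h3 := h2 0 (by omega)
  have h4 := h2 1 (by omega)
  simp [altLabel] at h3 h4
  rw [Prod.ext_iff.2 ⟨h3, h4⟩]

end Gadget

/-! ### Average-free maps into abelian groups -/

/-- An injection of labels into a group for which only constant sequences of `t` labels have the
sum of a constant sequence. -/
def AverageFree {I A : Type} [AddCommGroup A] (t : ℕ) (φ : I → A) : Prop :=
  ∀ (a : ℕ → I) (a₀ : I), ∑ i ∈ Finset.range t, φ (a i) = t • φ a₀ → ∀ i < t, a i = a₀

/-- Left and right labels move in different factors of the product, so the two sums separate. -/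
lemma AverageFree.sumRigid {I J A B : Type} [AddCommGroup A] [AddCommGroup B] {t : ℕ}
    {φ : I → A} {ψ : J → B} (hφ : AverageFree t φ) (hψ : AverageFree t ψ) :
    SumRigid t (Sum.elim (fun a => ((φ a, 0) : A × B)) (fun b => ((0, ψ b) : A × B))) := by
  intro a b a₀ b₀ h i hi
  have h1 := congrArg Prod.fst h
  have h2 := congrArg Prod.snd h
  simp [Prod.fst_sum, Prod.snd_sum] at h1 h2
  exact ⟨hφ a a₀ h1 i hi, hψ b b₀ h2 i hi⟩

/-- Points on a paraboloid: an average-free map on a discrete cube. -/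
lemma averageFree_paraboloid (t r d : ℕ) [NeZero (t * d)] [NeZero (t * (r * d ^ 2))] :
    AverageFree t (fun v : Fin r → Fin d =>
      (((fun l => ((v l : ℕ) : ZMod (t * d))), ((∑ l, (v l : ℕ) ^ 2 : ℕ) : ZMod (t * (r * d ^ 2)))) :
        (Fin r → ZMod (t * d)) × ZMod (t * (r * d ^ 2)))) := by
  intro a a₀ h
  have ht : 0 < t := Nat.pos_of_ne_zero fun h0 => NeZero.ne (t * d) (by simp [h0])
  -- Both moduli exceed every sum of `t` terms that occurs, so the equations hold in the integers.
  have h1 : ∀ l, ∑ i ∈ Finset.range t, (a i l : ℕ) = t * (a₀ l : ℕ) := by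
    intro l
    have := congrFun (congrArg Prod.fst h) l
    rw [Prod.fst_sum, Finset.sum_apply] at this
    simp only [nsmul_eq_mul] at this
    have h2 : ((∑ i ∈ Finset.range t, (a i l : ℕ) : ℕ) : ZMod (t * d)) =
        ((t * (a₀ l : ℕ) : ℕ) : ZMod (t * d)) := by
      push_cast
      exact this
    rw [ZMod.natCast_eq_natCast_iff'] at h2
    rwa [Nat.mod_eq_of_lt, Nat.mod_eq_of_lt] at h2
    · exact Nat.mul_lt_mul_of_pos_left (a₀ l).2 ht
    · calc _ < ∑ i ∈ Finset.range t, d :=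
            Finset.sum_lt_sum_of_nonempty (by simpa using ht.ne') fun i _ => (a i l).2
        _ = t * d := by simp
  have hlt : ∀ v : Fin r → Fin d, ∑ l, (v l : ℕ) ^ 2 < r * d ^ 2 := by
    intro v
    have hr : r * d ^ 2 ≠ 0 := fun h0 => NeZero.ne (t * (r * d ^ 2)) (by simp [h0])
    have : Nonempty (Fin r) := ⟨⟨0, Nat.pos_of_ne_zero fun h0 => hr (by simp [h0])⟩⟩
    calc _ < ∑ l : Fin r, d ^ 2 := Finset.sum_lt_sum_of_nonempty Finset.univ_nonempty
            fun l _ => Nat.pow_lt_pow_left (v l).2 two_ne_zero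
      _ = r * d ^ 2 := by simp
  have h2 : ∑ i ∈ Finset.range t, ∑ l, (a i l : ℕ) ^ 2 = t * ∑ l, (a₀ l : ℕ) ^ 2 := by
    have := congrArg Prod.snd h
    rw [Prod.snd_sum] at this
    simp only [nsmul_eq_mul] at this
    have h2 : ((∑ i ∈ Finset.range t, ∑ l, (a i l : ℕ) ^ 2 : ℕ) : ZMod (t * (r * d ^ 2))) =
        ((t * ∑ l, (a₀ l : ℕ) ^ 2 : ℕ) : ZMod (t * (r * d ^ 2))) := by
      push_cast at this ⊢
      exact this
    rw [ZMod.natCast_eq_natCast_iff'] at h2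
    rwa [Nat.mod_eq_of_lt, Nat.mod_eq_of_lt] at h2
    · exact Nat.mul_lt_mul_of_pos_left (hlt _) ht
    · calc _ < ∑ i ∈ Finset.range t, r * d ^ 2 :=
            Finset.sum_lt_sum_of_nonempty (by simpa using ht.ne') fun i _ => hlt _
        _ = t * (r * d ^ 2) := by simp
  -- The mean of the points `a i` is `a₀` and the mean of their squared norms is the squared norm of
  -- `a₀`; hence their variance about `a₀` is zero.
  have h3 : ∑ i ∈ Finset.range t, ∑ l, ((a i l : ℤ) - (a₀ l : ℤ)) ^ 2 = 0 := by
    have e1 : ∀ i l, ((a i l : ℤ) - (a₀ l : ℤ)) ^ 2 =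
        ((a i l : ℕ) : ℤ) ^ 2 - 2 * (a₀ l : ℕ) * (a i l : ℕ) + ((a₀ l : ℕ) : ℤ) ^ 2 := by
      intro i l; ring
    have e2 : ∑ i ∈ Finset.range t, ∑ l, 2 * ((a₀ l : ℕ) : ℤ) * (a i l : ℕ) =
        2 * (t * ∑ l, ((a₀ l : ℕ) : ℤ) ^ 2) := by
      rw [Finset.sum_comm, Finset.mul_sum, Finset.mul_sum]
      refine Finset.sum_congr rfl fun l _ => ?_
      rw [← Finset.mul_sum]
      have := congrArg (Nat.cast : ℕ → ℤ) (h1 l)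
      push_cast at this ⊢
      rw [this]
      ring
    have e3 := congrArg (Nat.cast : ℕ → ℤ) h2
    push_cast at e3
    simp only [e1, Finset.sum_add_distrib, Finset.sum_sub_distrib]
    rw [e2, e3, Finset.sum_const, Finset.card_range, nsmul_eq_mul]
    ring
  intro i hi
  have h4 := (Finset.sum_eq_zero_iff_of_nonneg fun i _ =>
    Finset.sum_nonneg fun l _ => sq_nonneg _).1 h3 i (Finset.mem_range.2 hi)
  funext l
  have h5 := (Finset.sum_eq_zero_iff_of_nonneg fun l _ => sq_nonneg _).1 h4 l (Finset.mem_univ l)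
  have h6 := pow_eq_zero_iff (two_ne_zero) |>.1 h5
  exact Fin.ext (by omega)

lemma AverageFree.comp_injective {I J A : Type} [AddCommGroup A] {t : ℕ} {φ : J → A}
    (hφ : AverageFree t φ) {f : I → J} (hf : Function.Injective f) : AverageFree t (φ ∘ f) :=
  fun a a₀ h i hi => hf (hφ (f ∘ a) (f a₀) h i hi)

lemma AverageFree.injective {I A : Type} [AddCommGroup A] {t : ℕ} (ht : 0 < t) {φ : I → A}
    (hφ : AverageFree t φ) : Function.Injective φ := by
  intro a b hab
  exact hφ (fun _ => a) b (by simp [hab]) 0 ht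

/-- Average-free maps into groups that are hardly larger than the set of labels. -/
lemma exists_averageFree (t : ℕ) (ht : 0 < t) (ε : ℝ) (hε : 0 < ε) :
    ∃ K : ℝ, 0 < K ∧ ∀ (I : Type) [Fintype I] [Nonempty I],
      ∃ (A : Type) (_ : AddCommGroup A) (_ : Fintype A) (φ : I → A), AverageFree t φ ∧
        Fintype.card I ≤ Fintype.card A ∧
        (Fintype.card A : ℝ) ≤ K * (Fintype.card I : ℝ) ^ (1 + ε) := by
  -- With `d` about `n ^ (1/r)` the cube has at least `n` points and the group has order about `n ^
  -- (1 + 2/r)`.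
  obtain ⟨r, hr⟩ := exists_nat_gt (2 / ε)
  have hr0 : (0 : ℝ) < r := (by positivity : (0 : ℝ) < 2 / ε).trans hr
  have hr1 : 0 < r := by exact_mod_cast hr0
  refine ⟨(t * 2) ^ r * (t * (r * 2 ^ 2)), by positivity, fun I _ _ => ?_⟩
  set n := Fintype.card I with hn
  have hn0 : 0 < n := Fintype.card_pos
  have hn1 : (1 : ℝ) ≤ n := by exact_mod_cast hn0
  set d := ⌈(n : ℝ) ^ (1 / (r : ℝ))⌉₊ with hd
  have hx1 : (1 : ℝ) ≤ (n : ℝ) ^ (1 / (r : ℝ)) := Real.one_le_rpow hn1 (by positivity)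
  have hd0 : 0 < d := Nat.ceil_pos.2 (by linarith)
  have hxr : ((n : ℝ) ^ (1 / (r : ℝ))) ^ r = n := by
    rw [← Real.rpow_natCast, ← Real.rpow_mul (by positivity)]
    field_simp
    simp
  have hd1 : (n : ℝ) ^ (1 / (r : ℝ)) ≤ d := Nat.le_ceil _
  have hd2 : (d : ℝ) ≤ 2 * (n : ℝ) ^ (1 / (r : ℝ)) := by
    have := (Nat.ceil_lt_add_one (a := (n : ℝ) ^ (1 / (r : ℝ))) (by linarith)).le
    linarith
  have hnd : n ≤ d ^ r := by
    have : (n : ℝ) ≤ (d : ℝ) ^ r := by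
      rw [← hxr]; gcongr
    exact_mod_cast this
  have i1 : NeZero (t * d) := ⟨by positivity⟩
  have i2 : NeZero (t * (r * d ^ 2)) := ⟨by positivity⟩
  obtain ⟨f⟩ : Nonempty (I ↪ (Fin r → Fin d)) := by
    rw [Function.Embedding.nonempty_iff_card_le]
    simpa using hnd
  have hφ := (averageFree_paraboloid t r d).comp_injective f.injective
  refine ⟨(Fin r → ZMod (t * d)) × ZMod (t * (r * d ^ 2)), inferInstance, inferInstance, _, hφ,
    Fintype.card_le_of_injective _ (hφ.injective ht), ?_⟩
  rw [Fintype.card_prod, Fintype.card_fun, ZMod.card, ZMod.card, Fintype.card_fin]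
  push_cast
  have h2 : ((n : ℝ) ^ (1 / (r : ℝ))) ^ 2 ≤ (n : ℝ) ^ ε := by
    rw [← Real.rpow_natCast, ← Real.rpow_mul (by positivity)]
    refine Real.rpow_le_rpow_of_exponent_le hn1 ?_
    rw [div_lt_iff₀ hε] at hr
    push_cast
    rw [one_div_mul_eq_div, div_le_iff₀ hr0]
    linarith
  calc ((t : ℝ) * d) ^ r * (t * (r * (d : ℝ) ^ 2))
      ≤ (t * (2 * (n : ℝ) ^ (1 / (r : ℝ)))) ^ r * (t * (r * (2 * (n : ℝ) ^ (1 / (r : ℝ))) ^ 2)) := by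
        gcongr
    _ = (t * 2) ^ r * (t * (r * 2 ^ 2)) * (((n : ℝ) ^ (1 / (r : ℝ))) ^ r *
        ((n : ℝ) ^ (1 / (r : ℝ))) ^ 2) := by ring
    _ ≤ (t * 2) ^ r * (t * (r * 2 ^ 2)) * ((n : ℝ) * (n : ℝ) ^ ε) := by
        rw [hxr]; gcongr
    _ = _ := by rw [Real.rpow_add (by linarith), Real.rpow_one]

/-! ### Powers and rounded powers -/

lemma eventually_const_mul_rpow_le (K : ℝ) {x y : ℝ} (hxy : x < y) :
    ∀ᶠ n : ℕ in atTop, K * (n : ℝ) ^ x ≤ (n : ℝ) ^ y := by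
  have h1 : Tendsto (fun n : ℕ => (n : ℝ) ^ (y - x)) atTop atTop :=
    (tendsto_rpow_atTop (sub_pos.2 hxy)).comp tendsto_natCast_atTop_atTop
  filter_upwards [h1.eventually_ge_atTop K, eventually_gt_atTop 0] with n hn hn0
  have hn0' : (0 : ℝ) < n := by exact_mod_cast hn0
  calc K * (n : ℝ) ^ x ≤ (n : ℝ) ^ (y - x) * (n : ℝ) ^ x := by gcongr
    _ = (n : ℝ) ^ y := by rw [← Real.rpow_add hn0']; congr 1; ring

lemma tendsto_floor_rpow {θ : ℝ} (hθ : 0 < θ) :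
    Tendsto (fun n : ℕ => ⌊(n : ℝ) ^ θ⌋₊) atTop atTop :=
  tendsto_nat_floor_atTop.comp ((tendsto_rpow_atTop hθ).comp tendsto_natCast_atTop_atTop)

lemma floor_rpow_rpow_le (n : ℕ) {θ x : ℝ} (hx : 0 < x) (hθ : θ = 1 / x) :
    ((⌊(n : ℝ) ^ θ⌋₊ : ℕ) : ℝ) ^ x ≤ n := by
  calc ((⌊(n : ℝ) ^ θ⌋₊ : ℕ) : ℝ) ^ x ≤ ((n : ℝ) ^ θ) ^ x := by
        gcongr
        exact Nat.floor_le (by positivity)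
    _ = n := by rw [← Real.rpow_mul (by positivity), hθ, one_div_mul_cancel hx.ne', Real.rpow_one]

lemma rpow_le_two_mul_floor {n : ℕ} (hn : 1 ≤ n) {θ : ℝ} (hθ : 0 ≤ θ) :
    (n : ℝ) ^ θ ≤ 2 * ((⌊(n : ℝ) ^ θ⌋₊ : ℕ) : ℝ) := by
  have h1 : (1 : ℝ) ≤ (n : ℝ) ^ θ := Real.one_le_rpow (by exact_mod_cast hn) hθ
  have h2 := Nat.lt_floor_add_one ((n : ℝ) ^ θ)
  have h3 : 1 ≤ ⌊(n : ℝ) ^ θ⌋₊ := Nat.le_floor (by simpa using h1)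
  have h4 : (1 : ℝ) ≤ (⌊(n : ℝ) ^ θ⌋₊ : ℕ) := by exact_mod_cast h3
  linarith

/-- A power of a rounded power: lower bound up to an arbitrarily small loss in the exponent. -/
lemma eventually_rpow_le_floor_rpow {θ x y : ℝ} (hθ : 0 < θ) (hx : 0 ≤ x) (hy : y < θ * x) :
    ∀ᶠ n : ℕ in atTop, (n : ℝ) ^ y ≤ ((⌊(n : ℝ) ^ θ⌋₊ : ℕ) : ℝ) ^ x := by
  filter_upwards [eventually_const_mul_rpow_le (2 ^ x) hy, eventually_ge_atTop 1] with n hn hn1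
  have h1 := rpow_le_two_mul_floor hn1 hθ.le
  have h2 : (n : ℝ) ^ (θ * x) ≤ 2 ^ x * ((⌊(n : ℝ) ^ θ⌋₊ : ℕ) : ℝ) ^ x := by
    rw [← Real.mul_rpow (by norm_num) (by positivity), Real.rpow_mul (by positivity)]
    gcongr
  exact le_of_mul_le_mul_left (hn.trans h2) (by positivity)

/-! ### The exponent under composition -/

/-- For all large `n` there are gadgets on at most `n` vertices in which the number of pairs is
roughly `n ^ α`, and the number of pairs of ports is not much larger. -/
def HasGadgets (g C D Y : ℕ) (α : ℝ) : Prop :=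
  ∀ ε : ℝ, 0 < ε → ∀ᶠ n : ℕ in atTop,
    ∃ (V I J : Type) (_ : Fintype I) (_ : Fintype J) (G : Gadget g C D Y V I J),
      G.supp.card ≤ n ∧ Fintype.card I + Fintype.card J ≤ n ∧
      ((Fintype.card I * Fintype.card J : ℕ) : ℝ) ≤ (n : ℝ) ^ (α + ε) ∧
      (n : ℝ) ^ (α - ε) ≤ (G.pairs.card : ℝ)

lemma Gadget.card_pairs_le {g C D Y : ℕ} {V I J : Type} [Fintype I] [Fintype J]
    (G : Gadget g C D Y V I J) : G.pairs.card ≤ Fintype.card I * Fintype.card J := by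
  have := Finset.card_le_univ G.pairs
  rwa [Fintype.card_prod] at this

/-- Up to small losses in the exponents, the group has order `|I| * |J| ≈ n ^ α`. The composition
then has about `n ^ (1 + α)` vertices, and both its pairs and its pairs of ports number about `n ^
(2 * α)`. The bound on pairs of ports in `HasGadgets` is what keeps the group small. -/
lemma HasGadgets.compose {g C D Y : ℕ} {α : ℝ} (hα : 0 < α) (H : HasGadgets g C D Y α)
    {w s t : ℕ} (ht : w + 1 = 2 * t) (hs : 0 < s) (hY : w * Y ≤ 2 * s) (hg : g + 1 ≤ s) :
    HasGadgets g (w * C + (w + 1) * s) (w * D + (w + 1) * s) (w * Y) (2 * α / (1 + α)) := by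
  intro ε hε
  have ht0 : 0 < t := by omega
  -- `η` is the loss allowed for the composed gadget. The smaller `δ` below is spent on the given
  -- gadget and on the average-free maps.
  obtain ⟨η, hη0, hη1, hη2, hη3⟩ : ∃ η : ℝ, 0 < η ∧ η < α ∧
      2 * (α + η) / (1 + α + η) < 2 * α / (1 + α) + ε ∧
      2 * α / (1 + α) - ε < (2 * α - η) / (1 + α + η) := by
    have c1 : ContinuousAt (fun η : ℝ => 2 * (α + η) / (1 + α + η)) 0 :=
      ContinuousAt.div (by fun_prop) (by fun_prop) (by simp; positivity)
    have c2 : ContinuousAt (fun η : ℝ => (2 * α - η) / (1 + α + η)) 0 :=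
      ContinuousAt.div (by fun_prop) (by fun_prop) (by simp; positivity)
    have e1 := c1.eventually_lt_const (u := 2 * α / (1 + α) + ε) (by simp; positivity)
    have e2 := c2.eventually_const_lt (u := 2 * α / (1 + α) - ε) (by simp; positivity)
    have e3 := eventually_lt_nhds hα
    obtain ⟨η, ⟨h3, h4, h2⟩, h1⟩ := (((e1.and (e2.and e3)).filter_mono
      (nhdsWithin_le_nhds (s := Set.Ioi 0))).and self_mem_nhdsWithin).exists
    exact ⟨η, h1, h2, h3, h4⟩
  obtain ⟨δ, hδ0, hδ1, hδ2⟩ : ∃ δ : ℝ, 0 < δ ∧ 2 * δ < η ∧ (α + δ) * (1 + δ) < α + η := by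
    have c1 : ContinuousAt (fun δ : ℝ => (α + δ) * (1 + δ)) 0 := by fun_prop
    have c2 : ContinuousAt (fun δ : ℝ => 2 * δ) 0 := by fun_prop
    have e1 := c1.eventually_lt_const (u := α + η) (by simp; positivity)
    have e2 := c2.eventually_lt_const (u := η) (by simp; positivity)
    obtain ⟨δ, ⟨h3, h2⟩, h1⟩ := (((e1.and e2).filter_mono
      (nhdsWithin_le_nhds (s := Set.Ioi 0))).and self_mem_nhdsWithin).exists
    exact ⟨δ, h1, h2, h3⟩
  obtain ⟨K, hK, hA⟩ := exists_averageFree t ht0 δ hδ0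
  have hθ : 0 < 1 / (1 + α + η) := by positivity
  have hlarge := tendsto_floor_rpow hθ
  filter_upwards [hlarge.eventually (H δ hδ0),
    hlarge.eventually (eventually_const_mul_rpow_le ((w + 2) * K ^ 2 * (1 + s))
      (x := (α + δ) * (1 + δ) + 1) (y := 1 + α + η) (by linarith)),
    hlarge.eventually (eventually_const_mul_rpow_le (K ^ 4)
      (x := 2 * ((α + δ) * (1 + δ))) (y := 2 * (α + η)) (by linarith)),
    hlarge.eventually_ge_atTop 1, eventually_ge_atTop 1,
    eventually_rpow_le_floor_rpow (θ := 1 / (1 + α + η)) (x := 2 * α - η)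
      (y := 2 * α / (1 + α) - ε) hθ (by linarith) (by rw [one_div_mul_eq_div]; exact hη3)]
    with n' hG hsize hports hn1 hn'1 hpairs
  have hle := floor_rpow_rpow_le n' (by positivity : 0 < 1 + α + η) rfl
  set n : ℕ := ⌊(n' : ℝ) ^ (1 / (1 + α + η))⌋₊ with hn
  have hn1' : (1 : ℝ) ≤ n := by exact_mod_cast hn1
  obtain ⟨V, I, J, _, _, G, hG1, hG2, hG3, hG4⟩ := hG
  have hpos : 0 < G.pairs.card := by
    have : (0 : ℝ) < G.pairs.card := lt_of_lt_of_le (by positivity) hG4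
    exact_mod_cast this
  obtain ⟨⟨a, b⟩, hab⟩ := Finset.card_pos.1 hpos
  have iI : Nonempty I := ⟨a⟩
  have iJ : Nonempty J := ⟨b⟩
  obtain ⟨A, _, _, φ, hφ, hA1, hA2⟩ := hA I
  obtain ⟨B, _, _, ψ, hψ, hB1, hB2⟩ := hA J
  have hcard : ((Fintype.card (A × B) : ℕ) : ℝ) ≤ K ^ 2 * (n : ℝ) ^ ((α + δ) * (1 + δ)) := by
    rw [Fintype.card_prod]
    push_cast
    calc (Fintype.card A : ℝ) * Fintype.card B
        ≤ (K * (Fintype.card I : ℝ) ^ (1 + δ)) * (K * (Fintype.card J : ℝ) ^ (1 + δ)) := by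
          gcongr
      _ = K ^ 2 * (((Fintype.card I * Fintype.card J : ℕ) : ℝ)) ^ (1 + δ) := by
          push_cast
          rw [Real.mul_rpow (by positivity) (by positivity)]
          ring
      _ ≤ K ^ 2 * ((n : ℝ) ^ (α + δ)) ^ (1 + δ) := by gcongr
      _ = _ := by rw [← Real.rpow_mul (by positivity)]
  have hcard' : G.pairs.card ≤ Fintype.card (A × B) := by
    rw [Fintype.card_prod]
    exact G.card_pairs_le.trans (Nat.mul_le_mul hA1 hB1)
  have hsum := hφ.sumRigid hψ
  refine ⟨_, A × B, A × B, inferInstance, inferInstance,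
    G.compose _ w s hs (G.left a) ht hsum hY hg (G.left_mem a), ?_, ?_, ?_, ?_⟩
  · rw [Gadget.card_supp_compose]
    have : (((w + 2) * (Fintype.card (A × B) * (G.supp.card +
        (Fintype.card I + Fintype.card J) * s)) : ℕ) : ℝ) ≤ n' := by
      push_cast
      have h1 : (G.supp.card : ℝ) ≤ n := by exact_mod_cast hG1
      have h2 : (Fintype.card I : ℝ) + Fintype.card J ≤ n := by exact_mod_cast hG2
      calc ((w : ℝ) + 2) * ((Fintype.card (A × B) : ℕ) * ((G.supp.card : ℝ) +
            ((Fintype.card I : ℝ) + Fintype.card J) * s))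
          ≤ (w + 2) * ((K ^ 2 * (n : ℝ) ^ ((α + δ) * (1 + δ))) * (n + n * s)) := by gcongr
        _ = (w + 2) * K ^ 2 * (1 + s) * ((n : ℝ) ^ ((α + δ) * (1 + δ)) * n) := by ring
        _ = (w + 2) * K ^ 2 * (1 + s) * (n : ℝ) ^ ((α + δ) * (1 + δ) + 1) := by
            rw [Real.rpow_add (by linarith), Real.rpow_one]
        _ ≤ _ := hsize.trans hle
    exact_mod_cast this
  · have : ((Fintype.card (A × B) + Fintype.card (A × B) : ℕ) : ℝ) ≤ n' := by
      push_cast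
      calc ((Fintype.card (A × B) : ℕ) : ℝ) + (Fintype.card (A × B) : ℕ)
          ≤ 2 * (K ^ 2 * (n : ℝ) ^ ((α + δ) * (1 + δ))) * (1 * 1) := by linarith
        _ ≤ (w + 2) * (K ^ 2 * (n : ℝ) ^ ((α + δ) * (1 + δ))) * ((1 + s) * n) := by
            gcongr
            · have : (0 : ℝ) ≤ w := by positivity
              linarith
            · have : (0 : ℝ) ≤ s := by positivity
              linarith
        _ = (w + 2) * K ^ 2 * (1 + s) * ((n : ℝ) ^ ((α + δ) * (1 + δ)) * n) := by ring
        _ = (w + 2) * K ^ 2 * (1 + s) * (n : ℝ) ^ ((α + δ) * (1 + δ) + 1) := by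
            rw [Real.rpow_add (by linarith), Real.rpow_one]
        _ ≤ _ := hsize.trans hle
    exact_mod_cast this
  · push_cast
    calc ((Fintype.card (A × B) : ℕ) : ℝ) * (Fintype.card (A × B) : ℕ)
        ≤ (K ^ 2 * (n : ℝ) ^ ((α + δ) * (1 + δ))) * (K ^ 2 * (n : ℝ) ^ ((α + δ) * (1 + δ))) := by
          gcongr
      _ = K ^ 4 * (n : ℝ) ^ (2 * ((α + δ) * (1 + δ))) := by
          rw [two_mul ((α + δ) * (1 + δ)), Real.rpow_add (by linarith)]
          ring
      _ ≤ (n : ℝ) ^ (2 * (α + η)) := hports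
      _ = ((n : ℝ) ^ (1 + α + η)) ^ (2 * (α + η) / (1 + α + η)) := by
          rw [← Real.rpow_mul (by positivity)]
          congr 1
          field_simp
      _ ≤ (n' : ℝ) ^ (2 * (α + η) / (1 + α + η)) := by gcongr
      _ ≤ _ := Real.rpow_le_rpow_of_exponent_le (by exact_mod_cast hn'1) hη2.le
  · rw [Gadget.card_pairs_compose]
    have h1 : ((G.pairs.card : ℕ) : ℝ) ≤ (Fintype.card (A × B) : ℕ) := by exact_mod_cast hcard'
    push_cast
    calc (n' : ℝ) ^ (2 * α / (1 + α) - ε) ≤ (n : ℝ) ^ (2 * α - η) := hpairs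
      _ ≤ (n : ℝ) ^ ((α - δ) + (α - δ)) :=
          Real.rpow_le_rpow_of_exponent_le hn1' (by linarith)
      _ = (n : ℝ) ^ (α - δ) * (n : ℝ) ^ (α - δ) := Real.rpow_add (by linarith) _ _
      _ ≤ (G.pairs.card : ℝ) * G.pairs.card := by gcongr
      _ ≤ _ := by gcongr

/-! ### Hitting sets and independent sets -/

/-- Few vertices hit a large part of a family of large sets. -/
lemma exists_hitting {E V : Type} [Fintype V] [DecidableEq V] [Nonempty V] (s : Finset E)
    (B : E → Finset V) (b : ℕ) (hB : ∀ e ∈ s, b ≤ (B e).card) (Q : ℕ) :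
    ∃ R : Finset V, R.card ≤ Q ∧ ((s.filter fun e => Disjoint (B e) R).card : ℝ) *
      (Fintype.card V + Q * b) ≤ s.card * Fintype.card V := by
  induction Q with
  | zero => exact ⟨∅, by simp, by simp⟩
  | succ Q ih =>
    obtain ⟨R, hR, h⟩ := ih
    set u := s.filter fun e => Disjoint (B e) R with hu
    have hsum : ∑ r : V, (u.filter fun e => r ∈ B e).card = ∑ e ∈ u, (B e).card := by
      simp only [Finset.card_filter]
      rw [Finset.sum_comm]
      refine Finset.sum_congr rfl fun e _ => ?_
      rw [← Finset.card_filter]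
      simp
    have hle : u.card * b ≤ ∑ e ∈ u, (B e).card := by
      rw [← smul_eq_mul, ← Finset.sum_const]
      exact Finset.sum_le_sum fun e he => hB e (Finset.mem_filter.1 he).1
    -- Greedy choice: some vertex lies in at least the average number of sets not hit so far.
    obtain ⟨r, -, hr⟩ : ∃ r ∈ (Finset.univ : Finset V),
        (u.card : ℝ) * b / Fintype.card V ≤ ((u.filter fun e => r ∈ B e).card : ℝ) := by
      refine Finset.exists_le_of_sum_le Finset.univ_nonempty ?_
      rw [Finset.sum_const, Finset.card_univ, nsmul_eq_mul, mul_div_cancel₀ _ (by positivity)]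
      exact_mod_cast hle.trans hsum.ge
    refine ⟨insert r R, (Finset.card_insert_le _ _).trans (by omega), ?_⟩
    have hn : (0 : ℝ) < Fintype.card V := by exact_mod_cast Fintype.card_pos
    have h1 : (s.filter fun e => Disjoint (B e) (insert r R)) = u.filter fun e => r ∉ B e := by
      ext e
      simp only [hu, Finset.mem_filter, Finset.disjoint_insert_right]
      tauto
    have h2 := Finset.card_filter_add_card_filter_not (s := u) (fun e => r ∈ B e)
    have h2' : ((u.filter fun e => r ∈ B e).card : ℝ) + ((u.filter fun e => r ∉ B e).card : ℝ) =
        u.card := by exact_mod_cast h2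
    rw [h1]
    rw [div_le_iff₀ hn] at hr
    set x : ℝ := ((u.filter fun e => r ∉ B e).card : ℝ)
    set n : ℝ := ((Fintype.card V : ℕ) : ℝ)
    have h3 : x * n ≤ u.card * (n - b) := by nlinarith
    -- The factor `1 - b/n` of one round is enough because `(n - b) * (n + (Q + 1) * b) ≤ n * (n + Q
    -- * b)`.
    have h4 : (x * (n + (Q + 1 : ℕ) * b)) * n ≤ (s.card * n) * n := by
      push_cast
      have hu0 : (0 : ℝ) ≤ u.card := by positivity
      have hb0 : (0 : ℝ) ≤ b := by positivity
      have hQ0 : (0 : ℝ) ≤ Q := by positivity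
      calc x * (n + (Q + 1) * b) * n = (x * n) * (n + (Q + 1) * b) := by ring
        _ ≤ (u.card * (n - b)) * (n + (Q + 1) * b) := by gcongr
        _ = u.card * (n + Q * b) * n - u.card * ((Q + 1) * b * b) := by ring
        _ ≤ u.card * (n + Q * b) * n := by
            have : (0 : ℝ) ≤ u.card * ((Q + 1) * b * b) := by positivity
            linarith
        _ ≤ _ := by gcongr
    exact le_of_mul_le_mul_right h4 hn

/-- A relation with few successors has a large independent set. -/
lemma exists_independent {E : Type} [DecidableEq E] (conf : E → E → Prop)
    [DecidableRel conf] (d : ℕ) (s : Finset E)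
    (hd : ∀ e ∈ s, (s.filter fun e' => conf e e').card ≤ d) :
    ∃ s' ⊆ s, s.card ≤ (2 * d + 1) * s'.card ∧
      ∀ e ∈ s', ∀ e' ∈ s', e ≠ e' → ¬ conf e e' := by
  induction hn : s.card using Nat.strong_induction_on generalizing s with
  | _ n ih =>
    subst hn
    rcases s.eq_empty_or_nonempty with rfl | hs
    · exact ⟨∅, by simp, by simp, by simp⟩
    have hsum : ∑ e ∈ s, (s.filter fun e' => conf e' e).card ≤ ∑ e ∈ s, d := by
      simp only [Finset.card_filter]
      rw [Finset.sum_comm]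
      simp only [← Finset.card_filter]
      exact Finset.sum_le_sum hd
    -- On average an element has at most `d` predecessors. One that attains this is kept, and its at
    -- most `2 * d` neighbours are discarded.
    obtain ⟨e₀, he₀, h0⟩ := Finset.exists_le_of_sum_le hs hsum
    set u := s.filter fun e => e ≠ e₀ ∧ ¬ conf e₀ e ∧ ¬ conf e e₀ with hu
    have hus : u ⊆ s := Finset.filter_subset _ _
    have hcard : s.card ≤ u.card + (2 * d + 1) := by
      have : s ⊆ u ∪ ({e₀} ∪ ((s.filter fun e' => conf e₀ e') ∪
          (s.filter fun e' => conf e' e₀))) := by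
        intro e he
        simp only [hu, Finset.mem_union, Finset.mem_filter, Finset.mem_singleton]
        tauto
      refine (Finset.card_le_card this).trans ((Finset.card_union_le _ _).trans ?_)
      have h1 := Finset.card_union_le ({e₀} : Finset E) ((s.filter fun e' => conf e₀ e') ∪
          (s.filter fun e' => conf e' e₀))
      have h2 := Finset.card_union_le (s.filter fun e' => conf e₀ e')
          (s.filter fun e' => conf e' e₀)
      have h3 := hd e₀ he₀
      rw [Finset.card_singleton] at h1
      omega
    have hlt : u.card < s.card := Finset.card_lt_card
      ⟨hus, fun h => by have := h he₀; simp [hu] at this⟩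
    obtain ⟨s', hs', hc, hi⟩ := ih u.card hlt u (fun e he => (Finset.card_le_card
      (Finset.filter_subset_filter _ hus)).trans (hd e (hus he))) rfl
    have hnot : e₀ ∉ s' := fun h => by have := hs' h; simp [hu] at this
    refine ⟨insert e₀ s', Finset.insert_subset he₀ (hs'.trans hus), ?_, ?_⟩
    · rw [Finset.card_insert_of_notMem hnot]
      linarith
    · intro e he e' he' hne
      rw [Finset.mem_insert] at he he'
      rcases he with rfl | he <;> rcases he' with rfl | he'
      · exact absurd rfl hne
      · exact (Finset.mem_filter.1 (hs' he')).2.2.1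
      · exact (Finset.mem_filter.1 (hs' he)).2.2.2
      · exact hi e he e' he' hne

/-! ### Base gadgets -/

lemma edgeSeparated_two {V : Type*} (G : SimpleGraph V) : EdgeSeparated 2 G := by
  classical
  intro x y hxy
  refine ⟨fun v => if v = x then 0 else if v = y then 2 else 1, ?_, ?_⟩
  · intro u v huv
    rw [SimpleGraph.deleteEdges_adj] at huv
    obtain ⟨h1, h2⟩ := huv
    rw [Set.mem_singleton_iff, Sym2.eq_iff] at h2
    have := h1.ne
    dsimp only
    split_ifs <;> simp_all
  · simp [hxy.ne.symm]

/-- The complete bipartite gadget. -/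
def bipartiteGadget (S : ℕ) : Gadget 2 1 1 2 (Fin S ⊕ Fin S) (Fin S) (Fin S) where
  supp := Finset.univ
  left := .inl
  right := .inr
  pairs := Finset.univ
  graph T := SimpleGraph.fromRel fun x y => ∃ a b, (a, b) ∉ T ∧ x = .inl a ∧ y = .inr b
  left_mem := by simp
  right_mem := by simp
  adj_mem := by simp
  girth _ := edgeSeparated_two _
  short := by
    intro T p _ hT
    refine (SimpleGraph.edist_eq_one_iff_adj.2 ?_).le
    rw [SimpleGraph.fromRel_adj]
    exact ⟨by simp, .inl ⟨_, _, hT, rfl, rfl⟩⟩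
  cross := by
    intro T
    refine ⟨Sum.elim (fun _ => 0) (fun _ => 1), ?_, by simp, by simp⟩
    rintro (u | u) (v | v) _ <;> simp
  block := by
    rintro T ⟨a, b⟩ - hT
    refine ⟨Sum.elim (fun a' => if a' = a then 0 else 2) (fun b' => if b' = b then 3 else 1),
      ?_, ?_, by simp, by simp, ?_, ?_⟩
    · rintro (u | u) (v | v) huv <;> rw [SimpleGraph.fromRel_adj] at huv <;>
        simp only [Sum.elim_inl, Sum.elim_inr]
      · simp at huv
      · have : ¬ (u = a ∧ v = b) := by rintro ⟨rfl, rfl⟩; simp_all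
        split_ifs <;> simp_all
      · split_ifs <;> simp_all
      · simp at huv
    · rintro (u | u) <;> simp only [Sum.elim_inl, Sum.elim_inr] <;> split_ifs <;> norm_num
    · intro a'; simp only [Sum.elim_inl]; split_ifs <;> norm_num
    · intro b'; simp only [Sum.elim_inr]; split_ifs <;> norm_num

lemma hasGadgets_bipartite : HasGadgets 2 1 1 2 2 := by
  intro ε hε
  filter_upwards [eventually_const_mul_rpow_le 16 (x := 2 - ε) (y := 2) (by linarith),
    eventually_ge_atTop 2] with n hn hn2
  have h1 : ((n / 2 : ℕ) : ℝ) ≤ n := by exact_mod_cast Nat.div_le_self n 2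
  have h2 : (n : ℝ) ≤ 4 * ((n / 2 : ℕ) : ℝ) := by exact_mod_cast (by omega : n ≤ 4 * (n / 2))
  have hn1 : (1 : ℝ) ≤ n := by exact_mod_cast (by omega : 1 ≤ n)
  rw [Real.rpow_two] at hn
  refine ⟨_, _, _, inferInstance, inferInstance, bipartiteGadget (n / 2), ?_, ?_, ?_, ?_⟩
  · simp [bipartiteGadget]; omega
  · simp; omega
  · rw [Fintype.card_fin]
    push_cast
    calc ((n / 2 : ℕ) : ℝ) * ((n / 2 : ℕ) : ℝ) ≤ n * n := by gcongr
      _ = (n : ℝ) ^ (2 : ℝ) := by rw [Real.rpow_two]; ring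
      _ ≤ _ := Real.rpow_le_rpow_of_exponent_le hn1 (by linarith)
  · have : (bipartiteGadget (n / 2)).pairs.card = (n / 2) * (n / 2) := by
      simp [bipartiteGadget]
    rw [this]
    push_cast
    nlinarith

section Sphere

variable {V : Type}

/-- On a shortest walk to `y`, the part up to a visit of `x` already has length `i`, so nothing is
left after it and `x = y`. -/
lemma exists_walk_avoiding {H : SimpleGraph V} {v x y : V} {i : ℕ} (hy : H.edist v y ≤ i)
    (hx : i ≤ H.edist v x) (hxy : x ≠ y) : ∃ p : H.Walk v y, p.length ≤ i ∧ x ∉ p.support := by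
  classical
  obtain ⟨p, hp⟩ := SimpleGraph.exists_walk_of_edist_ne_top
    (ne_top_of_le_ne_top (ENat.natCast_ne_top i) hy)
  have hpi : p.length ≤ i := by exact_mod_cast hp.trans_le hy
  refine ⟨p, hpi, fun hmem => hxy ?_⟩
  have h1 : i ≤ (p.takeUntil x hmem).length := by
    exact_mod_cast hx.trans (SimpleGraph.edist_le (p.takeUntil x hmem))
  have h2 := congrArg SimpleGraph.Walk.length (p.take_spec hmem)
  rw [SimpleGraph.Walk.length_append] at h2
  exact SimpleGraph.Walk.eq_of_length_eq_zero (p := p.dropUntil x hmem) (by omega)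

/-- In a graph of large girth a vertex has at most one neighbour that is not farther from `v`
than itself. -/
lemma EdgeSeparated.unique_predecessor {g : ℕ} {G H : SimpleGraph V} (hG : EdgeSeparated g G)
    (hH : H ≤ G) {v x y y' : V} {i : ℕ} (hig : 2 * i + 1 < g) (hxy : H.Adj x y)
    (hxy' : H.Adj x y') (hy : H.edist v y ≤ i) (hy' : H.edist v y' ≤ i)
    (hx : i ≤ H.edist v x) : y = y' := by
  by_contra hne
  obtain ⟨h, hh, hsep⟩ := hG x y (hH hxy)
  have hh := hh.mono (SimpleGraph.deleteEdges_mono hH)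
  obtain ⟨p, hp, hpx⟩ := exists_walk_avoiding hy hx hxy.ne
  obtain ⟨p', hp', hpx'⟩ := exists_walk_avoiding hy' hx hxy'.ne
  have h1 := hh.le_add_length_of_edges p (fun e he h1 => hpx (by
    rw [Set.mem_singleton_iff.1 h1] at he
    exact p.fst_mem_support_of_mem_edges he))
  have h2 := hh.neg.le_add_length_of_edges p' (fun e he h1 => hpx' (by
    rw [Set.mem_singleton_iff.1 h1] at he
    exact p'.fst_mem_support_of_mem_edges he))
  have h3 := hh x y' (by
    rw [SimpleGraph.deleteEdges_adj]
    refine ⟨hxy', fun h => hne ?_⟩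
    have := (Sym2.congr_right.1 (Set.mem_singleton_iff.1 h)).symm
    exact this)
  omega

lemma EdgeSeparated.le_edist {g : ℕ} {G : SimpleGraph V} (hG : EdgeSeparated g G) {u v : V}
    (huv : G.Adj u v) : (g : ℕ∞) ≤ (G.deleteEdges {s(u, v)}).edist v u := by
  obtain ⟨h, hh, hsep⟩ := hG u v huv
  exact hh.neg.le_edist (by omega)

variable [Fintype V]

/-- The vertices at distance `i` from `v` in `H`. -/
noncomputable def sphere (H : SimpleGraph V) (v : V) (i : ℕ) : Finset V :=
  letI := Classical.decPred fun x => H.edist v x = i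
  Finset.univ.filter fun x => H.edist v x = i

lemma mem_sphere {H : SimpleGraph V} {v x : V} {i : ℕ} : x ∈ sphere H v i ↔ H.edist v x = i := by
  simp [sphere]

/-- Double counting between consecutive spheres: below half the girth a vertex has at most one
neighbour that is not farther out, so all but one of its neighbours lie in the next sphere, and
these are not shared. -/
lemma EdgeSeparated.pow_le_card_sphere {g q : ℕ} {G : SimpleGraph V} [DecidableRel G.Adj]
    (hG : EdgeSeparated g G)
    (hq : ∀ v, q ≤ (Finset.univ.filter fun x => G.Adj v x).card) {u v : V} (huv : G.Adj u v)
    (i : ℕ) (hi : 2 * i < g + 1) : (q - 1) ^ i ≤ (sphere (G.deleteEdges {s(u, v)}) v i).card := by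
  classical
  set H := G.deleteEdges {s(u, v)} with hH
  have hHG : H ≤ G := SimpleGraph.deleteEdges_le _
  induction i with
  | zero =>
    rw [pow_zero, Nat.one_le_iff_ne_zero, ← Nat.pos_iff_ne_zero, Finset.card_pos]
    exact ⟨v, by simp [mem_sphere]⟩
  | succ i ih =>
    have ih := ih (by omega)
    have key := Finset.card_mul_le_card_mul (r := fun x y => H.Adj x y)
      (s := sphere H v i) (t := sphere H v (i + 1)) (m := q - 1) (n := 1) (by
        intro x hx
        rw [mem_sphere] at hx
        -- At `u` the deleted edge would cost a second neighbour. At `v` that edge is the only loss,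
        -- since `v` has no predecessor.
        have hxu : x ≠ u := by
          rintro rfl
          have := hG.le_edist huv
          rw [← hH, hx] at this
          have : g ≤ i := by exact_mod_cast this
          omega
        have hbad : ((Finset.univ.filter fun y => G.Adj x y).filter fun y =>
            ¬ (H.Adj x y ∧ y ∈ sphere H v (i + 1))).card ≤ 1 := by
          rw [Finset.card_le_one]
          have hnear : ∀ y, H.Adj x y → y ∉ sphere H v (i + 1) → H.edist v y ≤ i := by
            intro y hy hys
            rw [mem_sphere] at hys
            have h1 : H.edist v y ≤ ((i + 1 : ℕ) : ℕ∞) :=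
              (SimpleGraph.edist_triangle (v := x)).trans (by
                rw [hx, SimpleGraph.edist_eq_one_iff_adj.2 hy]
                push_cast
                rfl)
            have h2 := lt_of_le_of_ne h1 hys
            push_cast at h2
            exact Order.le_of_lt_add_one h2
          intro y hy y' hy'
          simp only [Finset.mem_filter, Finset.mem_univ, true_and] at hy hy'
          by_cases hxv : x = v
          · subst hxv
            have hi0 : i = 0 := by simpa using hx.symm
            subst hi0
            have aux : ∀ y, G.Adj x y → ¬ (H.Adj x y ∧ y ∈ sphere H x (0 + 1)) → y = u := by
              intro y hy hn
              by_contra hyu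
              have hHy : H.Adj x y := by
                rw [hH, SimpleGraph.deleteEdges_adj]
                refine ⟨hy, fun h => hyu ?_⟩
                rw [Set.mem_singleton_iff, Sym2.eq_swap (a := u)] at h
                exact Sym2.congr_right.1 h
              have := hnear y hHy (fun h => hn ⟨hHy, h⟩)
              rw [Nat.cast_zero, nonpos_iff_eq_zero, SimpleGraph.edist_eq_zero_iff] at this
              exact hHy.ne this
            rw [aux y hy.1 hy.2, aux y' hy'.1 hy'.2]
          · have hadj : ∀ y, G.Adj x y → H.Adj x y := by
              intro y hy
              rw [hH, SimpleGraph.deleteEdges_adj]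
              refine ⟨hy, fun h => ?_⟩
              rw [Set.mem_singleton_iff, Sym2.eq_iff] at h
              tauto
            have hy1 := hadj y hy.1
            have hy1' := hadj y' hy'.1
            exact hG.unique_predecessor hHG (by omega) hy1 hy1'
              (hnear y hy1 fun h => hy.2 ⟨hy1, h⟩) (hnear y' hy1' fun h => hy'.2 ⟨hy1', h⟩) hx.ge
        have hsplit := Finset.card_filter_add_card_filter_not
          (s := Finset.univ.filter fun y => G.Adj x y)
          (fun y => H.Adj x y ∧ y ∈ sphere H v (i + 1))
        have hsub : ((Finset.univ.filter fun y => G.Adj x y).filter fun y =>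
            H.Adj x y ∧ y ∈ sphere H v (i + 1)).card ≤
            (Finset.bipartiteAbove (fun x y => H.Adj x y) (sphere H v (i + 1)) x).card := by
          refine Finset.card_le_card fun y hy => ?_
          rw [Finset.mem_filter] at hy
          rw [Finset.mem_bipartiteAbove]
          exact ⟨hy.2.2, hy.2.1⟩
        have := hq x
        omega) (by
        intro y hy
        rw [mem_sphere] at hy
        rw [Finset.card_le_one]
        intro x hx x' hx'
        rw [Finset.mem_bipartiteBelow, mem_sphere] at hx hx'
        refine hG.unique_predecessor hHG (v := v) (x := y) (i := i) (by omega) hx.2.symm hx'.2.symm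
          hx.1.le hx'.1.le ?_
        rw [hy]
        exact_mod_cast Nat.le_succ i)
    rw [pow_succ]
    rw [mul_one] at key
    exact (Nat.mul_le_mul_right _ ih).trans key

end Sphere

/-- A graph of girth at least `2γ + 2` and minimum degree at least `q` yields a gadget with paths
of length `γ`, in which the first edge of each path lies on no other path. -/
lemma exists_girthGadget {γ q Q : ℕ} {V : Type} [Fintype V] [Nonempty V]
    (hγ : 1 ≤ γ) (hq0 : 1 ≤ q)
    {G : SimpleGraph V} (hG : EdgeSeparated (2 * γ + 1) G)
    (hq : ∀ v, q ≤ (G.neighborSet v).ncard) (hQ : Fintype.card V ≤ Q * (q - 1) ^ (γ - 1)) :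
    ∃ (J : Type) (_ : Fintype J) (A : Gadget (2 * γ) 0 γ (γ + 2) V V J),
      A.supp.card = Fintype.card V ∧ Fintype.card J ≤ Q ∧ Fintype.card J ≤ Fintype.card V ∧
      Fintype.card V * q ≤ 2 * (4 * γ + 1) * A.pairs.card := by
  classical
  have hq' : ∀ v, q ≤ (Finset.univ.filter fun x => G.Adj v x).card := by
    intro v
    refine (hq v).trans_eq ?_
    rw [Set.ncard_eq_toFinset_card']
    congr 1
    ext x
    simp
  let H : V × V → SimpleGraph V := fun e => G.deleteEdges {s(e.1, e.2)}
  have hHG : ∀ e, H e ≤ G := fun e => SimpleGraph.deleteEdges_le _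
  -- For a directed edge `(u, v)` these are the possible ends of a path of length `γ` that starts
  -- with it. The hubs `R` meet this set for at least half of the directed edges.
  let B : V × V → Finset V := fun e => sphere (H e) e.2 (γ - 1)
  let s : Finset (V × V) := Finset.univ.filter fun e => G.Adj e.1 e.2
  have hs : Fintype.card V * q ≤ s.card := by
    have : s.card = ∑ v, (Finset.univ.filter fun x => G.Adj v x).card := by
      simp only [s, Finset.card_filter, ← Finset.univ_product_univ, Finset.sum_product]
    rw [this, ← smul_eq_mul, Fintype.card, ← Finset.sum_const]
    exact Finset.sum_le_sum fun v _ => hq' v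
  obtain ⟨R, hRQ, hR⟩ := exists_hitting s B ((q - 1) ^ (γ - 1)) (fun e he =>
    hG.pow_le_card_sphere hq' (Finset.mem_filter.1 he).2 _ (by omega)) Q
  have hV : 0 < Fintype.card V := Fintype.card_pos
  let s₁ := s.filter fun e => ¬ Disjoint (B e) R
  have hs₁ : s.card ≤ 2 * s₁.card := by
    have h1 : 2 * (s.filter fun e => Disjoint (B e) R).card ≤ s.card := by
      have h2 : ((s.filter fun e => Disjoint (B e) R).card : ℝ) *
          (Fintype.card V + Fintype.card V) ≤ s.card * Fintype.card V := by
        refine le_trans ?_ hR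
        gcongr
        exact_mod_cast hQ
      have h3 : (2 * (s.filter fun e => Disjoint (B e) R).card) * Fintype.card V ≤
          s.card * Fintype.card V := by
        have : ((2 * (s.filter fun e => Disjoint (B e) R).card * Fintype.card V : ℕ) : ℝ) ≤
          ((s.card * Fintype.card V : ℕ) : ℝ) := by
          push_cast
          linarith
        exact_mod_cast this
      exact Nat.le_of_mul_le_mul_right h3 hV
    have h2 := Finset.card_filter_add_card_filter_not (s := s) (fun e => Disjoint (B e) R)
    simp only [s₁]
    omega
  have hs₁pos : 0 < s₁.card := by
    have : 0 < Fintype.card V * q := by positivity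
    omega
  have hRne : Nonempty {x // x ∈ R} := by
    obtain ⟨e, he⟩ := Finset.card_pos.1 hs₁pos
    obtain ⟨x, -, hx⟩ := Finset.not_disjoint_iff.1 (Finset.mem_filter.1 he).2
    exact ⟨⟨x, hx⟩⟩
  have hadj : ∀ e ∈ s₁, G.Adj e.1 e.2 := fun e he =>
    (Finset.mem_filter.1 (Finset.mem_filter.1 he).1).2
  have hex : ∀ e, ∃ r : {x // x ∈ R}, ∃ L : Finset (Sym2 V), e ∈ s₁ →
      (H e).edist e.2 r = ((γ - 1 : ℕ) : ℕ∞) ∧ L.card ≤ γ ∧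
      (∀ x ∈ L, x ∈ G.edgeSet) ∧ ∀ K : SimpleGraph V, (∀ x ∈ L, x ∈ K.edgeSet) → K.edist e.1 r ≤ γ := by
    intro e
    by_cases he : e ∈ s₁
    · obtain ⟨x, hxB, hxR⟩ := Finset.not_disjoint_iff.1 (Finset.mem_filter.1 he).2
      have hx : (H e).edist e.2 x = ((γ - 1 : ℕ) : ℕ∞) := mem_sphere.1 hxB
      obtain ⟨p, hp⟩ := SimpleGraph.exists_walk_of_edist_ne_top
        (G := H e) (u := e.2) (v := x) (by rw [hx]; exact ENat.natCast_ne_top _)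
      have hpl : p.length = γ - 1 := by exact_mod_cast hp.trans hx
      let w : G.Walk e.1 x := SimpleGraph.Walk.cons (hadj e he) (p.mapLe (hHG e))
      have hw : w.length = γ := by
        simp only [w, SimpleGraph.Walk.length_cons, SimpleGraph.Walk.length_mapLe, hpl]
        omega
      refine ⟨⟨x, hxR⟩, w.edges.toFinset, fun _ => ⟨hx, ?_, fun x hx => w.edges_subset_edgeSet (List.mem_toFinset.1 hx),
        fun K hK => ?_⟩⟩
      · exact (List.toFinset_card_le _).trans (by rw [SimpleGraph.Walk.length_edges, hw])
      · have h1 := SimpleGraph.edist_le (w.transfer K fun x hx => hK x (List.mem_toFinset.2 hx))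
        rwa [SimpleGraph.Walk.length_transfer, hw] at h1
    · exact ⟨Classical.arbitrary _, ∅, fun h => absurd h he⟩
  choose r L hrL using hex
  -- Two different first edges at `u` with the same hub would close up to a cycle of length at most
  -- `2 * γ`.
  have hinj : ∀ e ∈ s₁, ∀ e' ∈ s₁, e.1 = e'.1 → r e = r e' → e = e' := by
    rintro ⟨u, v⟩ he ⟨u', v'⟩ he' hu hr
    obtain rfl : u = u' := hu
    by_contra hne
    have hvv : v ≠ v' := fun h => hne (by rw [h])
    have huv := hadj _ he
    have huv' := hadj _ he'
    have h1 := (hrL _ he).1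
    have h2 := (hrL _ he').1
    rw [← hr] at h2
    dsimp only at huv huv' h1 h2
    obtain ⟨h, hh, hsep⟩ := hG u v huv
    have hfar := hG.le_edist huv'
    obtain ⟨p, hp⟩ := SimpleGraph.exists_walk_of_edist_ne_top
      (ne_top_of_le_ne_top (ENat.natCast_ne_top _) h1.le)
    have hpl : p.length = γ - 1 := by exact_mod_cast hp.trans h1
    obtain ⟨p', hpl', hpu⟩ := exists_walk_avoiding (H := H (u, v')) (x := u) h2.le
      (le_trans (by exact_mod_cast (by omega : γ - 1 ≤ 2 * γ + 1)) hfar) (by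
        intro hur
        rw [← hur] at h2
        have h3 : ((2 * γ + 1 : ℕ) : ℕ∞) ≤ ((γ - 1 : ℕ) : ℕ∞) := hfar.trans h2.le
        have h4 : 2 * γ + 1 ≤ γ - 1 := by exact_mod_cast h3
        omega)
    have i1 := hh.neg.le_add_length p
    have i2 := (hh.mono (SimpleGraph.deleteEdges_mono (hHG (u, v')))).le_add_length_of_edges p'
      (fun x hx h1 => hpu (by
        rw [Set.mem_singleton_iff.1 h1] at hx
        exact p'.fst_mem_support_of_mem_edges hx))
    have i3 := hh u v' (by
      rw [SimpleGraph.deleteEdges_adj]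
      refine ⟨huv', fun h => hvv ?_⟩
      exact (Sym2.congr_right.1 (Set.mem_singleton_iff.1 h)).symm)
    push_cast at hsep
    omega
  -- A path has at most `γ` edges with two orientations each, so it conflicts with at most `2 * γ`
  -- first edges. This gives the factor `4 * γ + 1`.
  obtain ⟨s₂, hs₂, hcard, hind⟩ := exists_independent
    (fun e e' : V × V => e ≠ e' ∧ s(e'.1, e'.2) ∈ L e) (2 * γ) s₁ (by
      intro e he
      have h1 : (s₁.filter fun e' => e ≠ e' ∧ s(e'.1, e'.2) ∈ L e).card ≤ 2 * (L e).card := by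
        refine Finset.card_le_mul_card_image_of_maps_to (f := fun e' : V × V => s(e'.1, e'.2))
          (fun e' he' => (Finset.mem_filter.1 he').2.2) 2 fun x hx => ?_
        induction x with
        | _ a b =>
          refine (Finset.card_le_card (t := {(a, b), (b, a)}) fun e' he' => ?_).trans
            Finset.card_le_two
          have := (Finset.mem_filter.1 he').2
          rw [Sym2.eq_iff] at this
          rw [Finset.mem_insert, Finset.mem_singleton, Prod.ext_iff, Prod.ext_iff]
          exact this
      exact h1.trans (Nat.mul_le_mul_left _ (hrL e he).2.1))
  let π : V × V → V × {x // x ∈ R} := fun e => (e.1, r e)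
  have hπ : Set.InjOn π s₂ := fun e he e' he' (h : π e = π e') =>
    hinj e (hs₂ he) e' (hs₂ he') (Prod.ext_iff.1 h).1 (Prod.ext_iff.1 h).2
  let K : Set (V × {x // x ∈ R}) → SimpleGraph V := fun T =>
    G.deleteEdges {x | ∃ e ∈ s₂, π e ∈ T ∧ x = s(e.1, e.2)}
  refine ⟨{x // x ∈ R}, inferInstance,
    { supp := Finset.univ
      left := id
      right := Subtype.val
      pairs := s₂.image π
      graph := K
      left_mem := by simp
      right_mem := by simp
      adj_mem := by simp
      girth := fun T => hG.mono (by omega) (SimpleGraph.deleteEdges_le _)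
      short := ?_
      cross := ?_
      block := ?_ }, ?_, ?_, ?_, ?_⟩
  · intro T p hp hT
    obtain ⟨e, he, rfl⟩ := Finset.mem_image.1 hp
    refine (hrL e (hs₂ he)).2.2.2 (K T) fun x hx => ?_
    rw [SimpleGraph.edgeSet_deleteEdges]
    refine ⟨(hrL e (hs₂ he)).2.2.1 x hx, ?_⟩
    rintro ⟨e', he', hT', rfl⟩
    have hne : e ≠ e' := by
      rintro rfl
      exact hT hT'
    exact hind e he e' he' hne ⟨hne, hx⟩
  · intro T
    exact ⟨fun _ => 0, IsPotential.const _ _, by simp, by simp⟩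
  · intro T p hp hT
    obtain ⟨e, he, rfl⟩ := Finset.mem_image.1 hp
    obtain ⟨h, hh, hsep⟩ := hG e.1 e.2 (hadj e (hs₂ he))
    have h1 := (hrL e (hs₂ he)).1
    obtain ⟨w, hw⟩ := SimpleGraph.exists_walk_of_edist_ne_top
      (ne_top_of_le_ne_top (ENat.natCast_ne_top _) h1.le)
    have hwl : w.length = γ - 1 := by exact_mod_cast hw.trans h1
    have i1 := hh.neg.le_add_length w
    have hK : IsPotential (K T) h := hh.mono (by
      intro a b hab
      rw [SimpleGraph.deleteEdges_adj] at hab ⊢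
      refine ⟨hab.1, fun h => hab.2 ⟨e, he, hT, h⟩⟩)
    refine ⟨_, (hK.add_const (-h e.1)).clamp 0 (γ + 2), ?_, ?_, ?_, ?_, ?_⟩
    · intro v; push_cast; omega
    · simp only [π, id]; omega
    · simp only [π]; push_cast at hsep ⊢; omega
    · intro a; push_cast; omega
    -- Here `C = 0`, so both side conditions are just the bounds of the clamp.
    · intro a; push_cast; omega
  · simp
  · simpa using hRQ
  · simpa using Finset.card_le_univ R
  · dsimp only
    rw [Finset.card_image_of_injOn hπ]
    calc Fintype.card V * q ≤ 2 * s₁.card := hs.trans hs₁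
      _ ≤ 2 * ((2 * (2 * γ) + 1) * s₂.card) := Nat.mul_le_mul_left _ hcard
      _ = _ := by ring

/-- Minimum degree `q` of order `n ^ (1/γ)` allows about `n / q ^ (γ - 1)`, again of order `n ^
(1/γ)`, hubs. So the pairs of ports and the directed edges both number `n ^ (1 + 1/γ)` up to
constants. -/
lemma hasGadgets_girth (hGirth : GirthConjecture) {γ : ℕ} (hγ : 1 ≤ γ) :
    HasGadgets (2 * γ) 0 γ (γ + 2) (1 + 1 / (γ : ℝ)) := by
  intro ε hε
  obtain ⟨c, hc, hG⟩ := hGirth γ hγ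
  have hγ0 : (0 : ℝ) < γ := by exact_mod_cast hγ
  set β : ℝ := 1 / (γ : ℝ) with hβ
  have hβ0 : 0 < β := by positivity
  set K : ℝ := (2 / c) ^ (γ - 1) + 1 with hK
  have hhalf : Tendsto (fun n : ℕ => n / 2) atTop atTop :=
    Nat.tendsto_div_const_atTop two_ne_zero
  have hbig : ∀ᶠ n : ℕ in atTop, 2 / c ≤ (n : ℝ) ^ β :=
    ((tendsto_rpow_atTop hβ0).comp tendsto_natCast_atTop_atTop).eventually_ge_atTop _
  filter_upwards [hhalf.eventually hG, hhalf.eventually_ge_atTop 1, hhalf.eventually hbig,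
    eventually_const_mul_rpow_le K (x := 1 + β) (y := 1 + β + ε) (by linarith),
    eventually_const_mul_rpow_le (2 * (4 * γ + 1) / c * 3 ^ (1 + β)) (x := 1 + β - ε)
      (y := 1 + β) (by linarith)]
    with N hGN hn1 hnbig hKN hPN
  -- All vertices are left ports and there may be as many hubs, so half of `N` makes room for both.
  set n := N / 2 with hn
  obtain ⟨G, hg, hdeg⟩ := hGN
  have hn0 : (1 : ℝ) ≤ n := by exact_mod_cast hn1
  have hN0 : (1 : ℝ) ≤ N := by exact_mod_cast (by omega : 1 ≤ N)
  have hnN : (n : ℝ) ≤ N := by exact_mod_cast (by omega : n ≤ N)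
  have hNn : (N : ℝ) ≤ 3 * n := by exact_mod_cast (by omega : N ≤ 3 * n)
  have : Nonempty (Fin n) := ⟨⟨0, hn1⟩⟩
  have hsep : EdgeSeparated (2 * γ + 1) G := edgeSeparated_of_le_egirth hg.ge
  set q := ⌈c * (n : ℝ) ^ β⌉₊ with hq
  have hcn : 2 ≤ c * (n : ℝ) ^ β := by
    rw [div_le_iff₀ hc] at hnbig
    linarith
  have hqle : c * (n : ℝ) ^ β ≤ q := Nat.le_ceil _
  have hq2 : 2 ≤ q := by
    have : (2 : ℝ) ≤ q := hcn.trans hqle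
    exact_mod_cast this
  have hq1 : c / 2 * (n : ℝ) ^ β ≤ (q - 1 : ℕ) := by
    push_cast [Nat.cast_sub (by omega : 1 ≤ q)]
    linarith
  have hpow : (n : ℝ) ^ β * ((n : ℝ) ^ β) ^ (γ - 1) = n := by
    rw [← pow_succ', Nat.sub_add_cancel hγ, ← Real.rpow_natCast, ← Real.rpow_mul (by positivity),
      hβ, one_div_mul_cancel hγ0.ne', Real.rpow_one]
  have hqp : 0 < ((q - 1 : ℕ) : ℝ) ^ (γ - 1) := by
    have : 0 < q - 1 := by omega
    positivity
  set Q := ⌈(n : ℝ) / ((q - 1 : ℕ) : ℝ) ^ (γ - 1)⌉₊ with hQ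
  have hQle : (Q : ℝ) ≤ K * (n : ℝ) ^ β := by
    have h1 : (n : ℝ) / ((q - 1 : ℕ) : ℝ) ^ (γ - 1) ≤ (2 / c) ^ (γ - 1) * (n : ℝ) ^ β := by
      rw [div_le_iff₀ hqp]
      calc (n : ℝ) = (2 / c) ^ (γ - 1) * (n : ℝ) ^ β * (c / 2 * (n : ℝ) ^ β) ^ (γ - 1) := by
            have h2 : (2 / c) ^ (γ - 1) * (c / 2) ^ (γ - 1) = 1 := by
              rw [← mul_pow, show 2 / c * (c / 2) = 1 by field_simp, one_pow]
            calc (n : ℝ) = ((2 / c) ^ (γ - 1) * (c / 2) ^ (γ - 1)) *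
                  ((n : ℝ) ^ β * ((n : ℝ) ^ β) ^ (γ - 1)) := by rw [h2, one_mul, hpow]
              _ = _ := by rw [mul_pow]; ring
        _ ≤ _ := by gcongr
    have h2 := (Nat.ceil_lt_add_one (a := (n : ℝ) / ((q - 1 : ℕ) : ℝ) ^ (γ - 1)) (by positivity)).le
    have h3 : (1 : ℝ) ≤ (n : ℝ) ^ β := Real.one_le_rpow hn0 hβ0.le
    rw [hK, add_mul, one_mul]
    linarith
  obtain ⟨J, _, A, hA1, hA2, hA3, hA4⟩ := exists_girthGadget (γ := γ) (q := q) (Q := Q) hγ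
    (by omega) hsep (fun v => Nat.ceil_le.2 (hdeg v)) (by
      have h1 : (n : ℝ) / ((q - 1 : ℕ) : ℝ) ^ (γ - 1) ≤ Q := Nat.le_ceil _
      rw [div_le_iff₀ hqp] at h1
      rw [Fintype.card_fin]
      exact_mod_cast h1)
  rw [Fintype.card_fin] at hA1 hA3 hA4
  refine ⟨_, _, J, inferInstance, inferInstance, A, by omega, by
    rw [Fintype.card_fin]; omega, ?_, ?_⟩
  · rw [Fintype.card_fin]
    push_cast
    calc (n : ℝ) * Fintype.card J ≤ N * (K * (N : ℝ) ^ β) := by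
          gcongr
          calc ((Fintype.card J : ℕ) : ℝ) ≤ Q := by exact_mod_cast hA2
            _ ≤ _ := hQle
            _ ≤ K * (N : ℝ) ^ β := by gcongr
      _ = K * (N : ℝ) ^ (1 + β) := by
          rw [Real.rpow_add (by linarith), Real.rpow_one]; ring
      _ ≤ _ := hKN
  · have h1 : (n : ℝ) * q ≤ 2 * (4 * γ + 1) * A.pairs.card := by exact_mod_cast hA4
    have h2 : c * (n : ℝ) ^ (1 + β) ≤ 2 * (4 * γ + 1) * A.pairs.card := by
      calc c * (n : ℝ) ^ (1 + β) = n * (c * (n : ℝ) ^ β) := by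
            rw [Real.rpow_add (by linarith), Real.rpow_one]; ring
        _ ≤ n * q := by gcongr
        _ ≤ _ := h1
    have h3 : (N : ℝ) ^ (1 + β) ≤ 3 ^ (1 + β) * (n : ℝ) ^ (1 + β) := by
      rw [← Real.mul_rpow (by norm_num) (by positivity)]
      gcongr
    have h4 : 2 * (4 * γ + 1) / c * 3 ^ (1 + β) * (N : ℝ) ^ (1 + β - ε) ≤
        2 * (4 * γ + 1) / c * 3 ^ (1 + β) * A.pairs.card := by
      calc _ ≤ _ := hPN
        _ ≤ 3 ^ (1 + β) * (n : ℝ) ^ (1 + β) := h3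
        _ = 3 ^ (1 + β) / c * (c * (n : ℝ) ^ (1 + β)) := by field_simp
        _ ≤ 3 ^ (1 + β) / c * (2 * (4 * γ + 1) * A.pairs.card) := by gcongr
        _ = _ := by ring
    exact le_of_mul_le_mul_left h4 (by positivity)

/-! ### Iterating the composition -/

/-- The invariant `Y ≤ 2 * (γ * w ^ m)` permits the step length `s = γ * w ^ (m + 1)` in the next
round. It fails for the girth gadget with `γ = 1`, where `Y = 3`; hence the bipartite start.
Connecting paths add equally to `C` and `D`, so the gap is simply multiplied by `w`. -/
lemma exists_hasGadgets (hGirth : GirthConjecture) {γ : ℕ} (hγ : 1 ≤ γ) {w t : ℕ}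
    (hwt : w + 1 = 2 * t) (hw : 2 * γ + 1 ≤ w) (m : ℕ) :
    ∃ C D Y : ℕ, HasGadgets (2 * γ) C D Y (1 + 1 / (((γ : ℝ) + 1) * 2 ^ m - 1)) ∧
      D = γ * w ^ m * (1 + m * (w + 1)) ∧ C + Y = D + 2 * w ^ m ∧ Y ≤ 2 * (γ * w ^ m) ∧
      (1 ≤ m → w ≤ C) := by
  have hγ0 : (1 : ℝ) ≤ γ := by exact_mod_cast hγ
  have hw0 : 0 < w := by omega
  induction m with
  | zero =>
    rcases hγ.eq_or_lt with rfl | hγ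
    · refine ⟨1, 1, 2, ?_, by simp, by simp, by simp, by simp⟩
      convert hasGadgets_bipartite using 1
      norm_num
    · refine ⟨0, γ, γ + 2, ?_, by simp, by simp, by simp; omega, by simp⟩
      convert hasGadgets_girth hGirth (by omega : 1 ≤ γ) using 1
      simp
  | succ m ih =>
    obtain ⟨C, D, Y, H, hD, hCY, hY, -⟩ := ih
    have hwm : 0 < w ^ m := by positivity
    have hpow : (1 : ℝ) ≤ 2 ^ m := one_le_pow₀ (by norm_num)
    have he : 0 < ((γ : ℝ) + 1) * 2 ^ m - 1 := by nlinarith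
    have hs : 2 * γ + 1 ≤ γ * w ^ (m + 1) := by
      calc 2 * γ + 1 ≤ 1 * (1 * w) := by omega
        _ ≤ γ * (w ^ m * w) := by gcongr; exact hwm
        _ = _ := by rw [pow_succ]
    have hY' : w * Y ≤ 2 * (γ * w ^ (m + 1)) := by
      calc w * Y ≤ w * (2 * (γ * w ^ m)) := Nat.mul_le_mul_left _ hY
        _ = _ := by ring
    have hα : 0 < 1 + 1 / (((γ : ℝ) + 1) * 2 ^ m - 1) := by positivity
    refine ⟨w * C + (w + 1) * (γ * w ^ (m + 1)), w * D + (w + 1) * (γ * w ^ (m + 1)), w * Y,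
      ?_, ?_, ?_, hY', fun _ => ?_⟩
    · convert H.compose hα hwt (by omega) hY' hs using 1
      have h1 : ((γ : ℝ) + 1) * 2 ^ (m + 1) - 1 = 2 * (((γ : ℝ) + 1) * 2 ^ m - 1) + 1 := by ring
      rw [h1]
      generalize ((γ : ℝ) + 1) * 2 ^ m - 1 = e at he
      have h2 : 1 + (1 + 1 / e) ≠ 0 := by positivity
      field_simp
      ring
    · rw [hD]; ring
    · calc w * C + (w + 1) * (γ * w ^ (m + 1)) + w * Y
          = w * (C + Y) + (w + 1) * (γ * w ^ (m + 1)) := by ring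
        _ = _ := by rw [hCY]; ring
    · have : w * 1 ≤ (w + 1) * (γ * w ^ (m + 1)) := Nat.mul_le_mul (by omega) (by omega)
      omega

/-! ### From gadgets to data structures -/

section Transfer

variable {V : Type} {n : ℕ}

/-- The copy of a graph on `Fin n` under a numbering of its vertices. -/
def numbered (H : SimpleGraph V) (j : V → Fin n) : SimpleGraph (Fin n) :=
  SimpleGraph.fromRel fun a b => ∃ x y, H.Adj x y ∧ j x = a ∧ j y = b

variable {H : SimpleGraph V} {j : V → Fin n} {s : Set V}

lemma numbered_adj {a b : Fin n} :
    (numbered H j).Adj a b → ∃ x y, H.Adj x y ∧ j x = a ∧ j y = b := by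
  rw [numbered, SimpleGraph.fromRel_adj]
  rintro ⟨-, h | ⟨x, y, h, hx, hy⟩⟩
  · exact h
  · exact ⟨y, x, h.symm, hy, hx⟩

lemma adj_numbered (hj : s.InjOn j) (hs : ∀ x y, H.Adj x y → x ∈ s) {x y : V} (h : H.Adj x y) :
    (numbered H j).Adj (j x) (j y) := by
  rw [numbered, SimpleGraph.fromRel_adj]
  exact ⟨fun he => h.ne (hj (hs _ _ h) (hs _ _ h.symm) he), .inl ⟨x, y, h, rfl, rfl⟩⟩

lemma edist_numbered_le (hj : s.InjOn j) (hs : ∀ x y, H.Adj x y → x ∈ s) (x y : V) :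
    (numbered H j).edist (j x) (j y) ≤ H.edist x y := by
  refine le_iInf fun p => ?_
  let f : H →g numbered H j := ⟨j, fun h => adj_numbered hj hs h⟩
  have := SimpleGraph.edist_le (p.map f)
  rwa [SimpleGraph.Walk.length_map] at this

lemma IsPotential.numbered [Nonempty V] (hj : s.InjOn j) (hs : ∀ x y, H.Adj x y → x ∈ s)
    {h : V → ℤ} (hh : IsPotential H h) :
    IsPotential (numbered H j) (fun a => h (Function.invFunOn j s a)) := by
  intro a b hab
  obtain ⟨x, y, hxy, rfl, rfl⟩ := numbered_adj hab
  dsimp only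
  rw [hj.leftInvOn_invFunOn (hs _ _ hxy), hj.leftInvOn_invFunOn (hs _ _ hxy.symm)]
  exact hh x y hxy

lemma EdgeSeparated.numbered [Nonempty V] {g : ℕ} (hj : s.InjOn j)
    (hs : ∀ x y, H.Adj x y → x ∈ s) (hH : EdgeSeparated g H) :
    EdgeSeparated g (numbered H j) := by
  intro a b hab
  obtain ⟨x, y, hxy, rfl, rfl⟩ := numbered_adj hab
  obtain ⟨h, hh, hsep⟩ := hH x y hxy
  have hs' : ∀ x' y', (H.deleteEdges {s(x, y)}).Adj x' y' → x' ∈ s :=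
    fun x' y' h => hs x' y' (SimpleGraph.deleteEdges_le _ h)
  refine ⟨_, (hh.numbered hj hs').mono ?_, ?_⟩
  · intro a b hab
    rw [SimpleGraph.deleteEdges_adj] at hab
    obtain ⟨x', y', hxy', rfl, rfl⟩ := numbered_adj hab.1
    refine adj_numbered hj hs' ?_
    rw [SimpleGraph.deleteEdges_adj]
    refine ⟨hxy', fun h => hab.2 ?_⟩
    have := congrArg (Sym2.map j) (Set.mem_singleton_iff.1 h)
    simpa using this
  · rw [hj.leftInvOn_invFunOn (hs _ _ hxy), hj.leftInvOn_invFunOn (hs _ _ hxy.symm)]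
    exact hsep

end Transfer

/-- An injective code of `2 ^ N` objects uses a word of length at least `N`. -/
lemma exists_long_word {α : Type*} [Fintype α] {N : ℕ} (hα : Fintype.card α = 2 ^ N)
    (F : α → List Bool) (hF : Function.Injective F) : ∃ a, N ≤ (F a).length := by
  by_contra! hcon
  -- There are only `2 ^ N - 1` words shorter than `N`.
  let F' : α → Σ i : Fin N, List.Vector Bool i := fun a => ⟨⟨(F a).length, hcon a⟩, ⟨F a, rfl⟩⟩
  have hF' : Function.Injective F' := by
    intro a b hab
    have h1 : (F a) = (F b) :=
      congrArg (fun x : Σ i : Fin N, List.Vector Bool i => x.2.1) hab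
    exact hF h1
  have h := Fintype.card_le_of_injective F' hF'
  rw [hα, Fintype.card_sigma] at h
  simp only [card_vector, Fintype.card_bool] at h
  rw [Fin.sum_univ_eq_sum_range (fun i => 2 ^ i) N] at h
  have h2 := Nat.geomSum_lt (m := 2) (n := N) (s := Finset.range N) le_rfl (by simp)
  omega

lemma Gadget.exists_long_encoding {g C D Y n : ℕ} {V I J : Type} (A : Gadget g C D Y V I J)
    (hn : A.supp.card ≤ n) (hP : 0 < A.pairs.card) {f : ℕ → ℝ≥0}
    (hf : ∀ d, C ≤ d → d ≤ D → (f d : ℝ) < C + Y)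
    (S : ApproxDistanceDataStructure (g + 1) n f) :
    ∃ G, A.pairs.card ≤ (S.encode G).length := by
  classical
  obtain ⟨⟨a₀, b₀⟩, -⟩ := Finset.card_pos.1 hP
  have : Nonempty V := ⟨A.left a₀⟩
  have hn0 : 0 < n := (Finset.card_pos.2 ⟨_, A.left_mem a₀⟩).trans_le hn
  obtain ⟨ι⟩ : Nonempty ({x // x ∈ A.supp} ↪ Fin n) := by
    rw [Function.Embedding.nonempty_iff_card_le]
    simpa using hn
  let j : V → Fin n := fun x => if h : x ∈ A.supp then ι ⟨x, h⟩ else ⟨0, hn0⟩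
  have hj : (A.supp : Set V).InjOn j := by
    intro x hx y hy hxy
    simp only [j, dif_pos (Finset.mem_coe.1 hx), dif_pos (Finset.mem_coe.1 hy)] at hxy
    simpa using ι.injective hxy
  let G : {T // T ∈ A.pairs.powerset} → GraphOfGirthAtLeast (g + 1) n := fun T =>
    ⟨numbered (A.graph (T.1 : Set (I × J))) j,
      ((A.girth _).numbered hj (A.adj_mem _)).le_egirth⟩
  -- If `p` is blocked in `T` but not in `T'`, a common code would give one estimate that is at
  -- least `C + Y` and at most `f d` for some `d` in `[C, D]`.
  have key : ∀ T T' : {T // T ∈ A.pairs.powerset}, S.encode (G T) = S.encode (G T') →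
      T.1 ⊆ T'.1 := by
    intro T T' hTT p hp
    by_contra hp'
    have hpP := Finset.mem_powerset.1 T.2 hp
    obtain ⟨h, hh, -, h0, h1, -, -⟩ := A.block (T.1 : Set (I × J)) p hpP (by exact_mod_cast hp)
    have e1 : ((C + Y : ℕ) : ℕ∞) ≤ (G T).1.edist (j (A.left p.1)) (j (A.right p.2)) := by
      refine (hh.numbered hj (A.adj_mem _)).le_edist ?_
      rw [hj.leftInvOn_invFunOn (A.left_mem _), hj.leftInvOn_invFunOn (A.right_mem _), h0, h1]
      push_cast
      omega
    have e2 : (G T').1.edist (j (A.left p.1)) (j (A.right p.2)) ≤ D :=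
      (edist_numbered_le hj (A.adj_mem _) _ _).trans
        (A.short _ p hpP (by exact_mod_cast hp'))
    obtain ⟨k, hk, k0, k1⟩ := A.cross (T'.1 : Set (I × J))
    have e3 : (C : ℕ∞) ≤ (G T').1.edist (j (A.left p.1)) (j (A.right p.2)) := by
      refine (hk.numbered hj (A.adj_mem _)).le_edist ?_
      rw [hj.leftInvOn_invFunOn (A.left_mem _), hj.leftInvOn_invFunOn (A.right_mem _), k0, k1,
        zero_add]
    have hreach : (G T').1.Reachable (j (A.left p.1)) (j (A.right p.2)) :=
      SimpleGraph.edist_ne_top_iff_reachable.1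
        (ne_top_of_le_ne_top (ENat.natCast_ne_top _) e2)
    have e4 := S.edist_le_query (G T) (j (A.left p.1)) (j (A.right p.2))
    have e5 := S.query_le (G T') (j (A.left p.1)) (j (A.right p.2)) hreach
    rw [← hTT] at e5
    rw [← hreach.coe_dist_eq_edist] at e2 e3
    have hd := hf _ (by exact_mod_cast e3) (by exact_mod_cast e2)
    have e6 : (((C + Y : ℕ) : ℝ≥0) : ℝ≥0∞) ≤
        (f ((G T').1.dist (j (A.left p.1)) (j (A.right p.2))) : ℝ≥0∞) := by
      refine le_trans ?_ (e4.trans e5)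
      have := ENat.toENNReal_le.2 e1
      simpa using this
    have e7 := NNReal.coe_le_coe.2 (ENNReal.coe_le_coe.1 e6)
    push_cast at e7
    linarith
  obtain ⟨T, hT⟩ := exists_long_word (N := A.pairs.card) (by simp)
    (fun T => S.encode (G T)) (fun T T' h =>
      Subtype.ext ((key T T' h).antisymm (key T' T h.symm)))
  exact ⟨G T, hT⟩

/-! ### The lower bound on the number of bits -/

/-- The length is `γ * (m + (1 + m) / w) * w ^ (m + 1)`, and `(m + 1) * (1 - 1 / (m + 1)) = m`. So
the quotient of the left side by `w ^ m` tends to `c * (γ * m) ^ (1 - 1 / (m + 1)) < 2`. -/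
lemma eventually_const_mul_length_rpow_le {γ m : ℕ} (hγ : 1 ≤ γ) (hm : 1 ≤ m) {c : ℝ}
    (hc : c < 2 / ((γ : ℝ) * m) ^ (1 - 1 / ((m : ℝ) + 1))) :
    ∀ᶠ w : ℕ in atTop, c * ((γ * w ^ m * (1 + m * (w + 1)) : ℕ) : ℝ) ^ (1 - 1 / ((m : ℝ) + 1)) ≤
      2 * (w : ℝ) ^ m := by
  set x : ℝ := 1 - 1 / ((m : ℝ) + 1) with hx
  have hγ0 : (0 : ℝ) < γ := by exact_mod_cast hγ
  have hm0 : (0 : ℝ) < m := by exact_mod_cast hm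
  have hmx : ((m : ℝ) + 1) * x = m := by rw [hx]; field_simp; ring
  have hlim : Tendsto (fun w : ℕ => c * ((γ : ℝ) * (m + (1 + m) / (w : ℝ))) ^ x) atTop
      (𝓝 (c * ((γ : ℝ) * (m + 0)) ^ x)) := by
    refine Tendsto.const_mul _ (Tendsto.rpow_const ?_ (.inl (by positivity)))
    exact (tendsto_const_nhds.add (tendsto_const_div_atTop_nhds_zero_nat _)).const_mul _
  have hlt : c * ((γ : ℝ) * (m + 0)) ^ x < 2 := by
    rw [add_zero]
    rwa [lt_div_iff₀ (by positivity)] at hc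
  filter_upwards [hlim.eventually_lt_const hlt, eventually_gt_atTop 0] with w hw hw0
  have hw0' : (0 : ℝ) < w := by exact_mod_cast hw0
  have h1 : ((γ * w ^ m * (1 + m * (w + 1)) : ℕ) : ℝ) =
      ((γ : ℝ) * (m + (1 + m) / (w : ℝ))) * (w : ℝ) ^ ((m : ℝ) + 1) := by
    rw [Real.rpow_add hw0', Real.rpow_natCast, Real.rpow_one]
    push_cast
    field_simp
    ring
  rw [h1, Real.mul_rpow (by positivity) (by positivity), ← Real.rpow_mul hw0'.le, hmx,
    Real.rpow_natCast, ← mul_assoc]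
  gcongr

/-- The lower bound on the number of bits, with an arbitrarily small loss in the exponent. -/
lemma eventually_exists_long_encoding (hGirth : GirthConjecture) {γ k : ℕ} (hγ : 1 ≤ γ)
    (hk : 2 ≤ k) {c : ℝ} (hc : c < 2 / ((γ : ℝ) * ((k : ℝ) - 1)) ^ (1 - 1 / (k : ℝ))) (d₀ : ℕ)
    {ε : ℝ} (hε : 0 < ε) :
    ∀ᶠ n : ℕ in atTop, ∀ f : ℕ → ℝ≥0,
      (∀ d : ℕ, d₀ ≤ d → (f d : ℝ) < (d : ℝ) + c * (d : ℝ) ^ (1 - 1 / (k : ℝ))) →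
      ∀ S : ApproxDistanceDataStructure (2 * γ + 1) n f,
        ∃ G : GraphOfGirthAtLeast (2 * γ + 1) n,
          (n : ℝ) ^ (1 + 1 / (((γ : ℝ) + 1) * 2 ^ (k - 1) - 1) - ε) ≤
            ((S.encode G).length : ℝ) := by
  obtain ⟨m, rfl⟩ : ∃ m, k = m + 1 := ⟨k - 1, by omega⟩
  have hm : 1 ≤ m := by omega
  have hγ0 : (0 : ℝ) < γ := by exact_mod_cast hγ
  have hm0 : (0 : ℝ) < m := by exact_mod_cast hm
  push_cast at hc ⊢
  rw [add_sub_cancel_right] at hc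
  have hx : 0 ≤ 1 - 1 / ((m : ℝ) + 1) := by
    rw [sub_nonneg, div_le_one (by positivity)]
    linarith
  -- A negative `c` is replaced by 0, which makes the stretch bound monotone in `d`.
  have hc' : max c 0 < 2 / ((γ : ℝ) * m) ^ (1 - 1 / ((m : ℝ) + 1)) :=
    max_lt hc (by positivity)
  obtain ⟨w₀, hw₀⟩ := eventually_atTop.1 (eventually_const_mul_length_rpow_le hγ hm hc')
  -- This makes `w` odd and at least `w₀`, `d₀` and `2 * γ + 1`. Since `w ≤ C`, all distances in
  -- `[C, D]` lie where the bound on `f` is assumed.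
  set t := w₀ + d₀ + 2 * γ + 1 with ht
  set w := 2 * t - 1 with hw
  have hlen := hw₀ w (by omega)
  obtain ⟨C, D, Y, H, hD, hCY, -, hwC⟩ := exists_hasGadgets hGirth hγ
    (show w + 1 = 2 * t by omega) (by omega) m
  rw [← hD] at hlen
  filter_upwards [H ε hε, eventually_gt_atTop 0] with n hn hn0 f hf S
  obtain ⟨V, I, J, _, _, A, hA1, -, -, hA2⟩ := hn
  have hP : 0 < A.pairs.card := by
    have : (0 : ℝ) < A.pairs.card := lt_of_lt_of_le (by positivity) hA2
    exact_mod_cast this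
  obtain ⟨G, hG⟩ := A.exists_long_encoding hA1 hP (f := f) (fun d hCd hdD => by
    have h1 := hf d (by have := hwC hm; omega)
    have h2 : c * (d : ℝ) ^ (1 - 1 / ((m : ℝ) + 1)) ≤
        max c 0 * (D : ℝ) ^ (1 - 1 / ((m : ℝ) + 1)) := by
      have : (d : ℝ) ≤ D := by exact_mod_cast hdD
      gcongr
      exact le_max_left _ _
    have h3 : (d : ℝ) ≤ D := by exact_mod_cast hdD
    have h4 : (C : ℝ) + Y = D + 2 * (w : ℝ) ^ m := by exact_mod_cast hCY
    linarith) S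
  exact ⟨G, hA2.trans (by exact_mod_cast hG)⟩

/-- Countably many eventual properties that hold with every positive loss `ε` hold with one loss
`δ n` that tends to zero. -/
lemma exists_tendsto_zero_eventually (Q : ℕ → ℕ → ℝ → Prop)
    (hQ : ∀ i, ∀ ε : ℝ, 0 < ε → ∀ᶠ n in atTop, Q i n ε) :
    ∃ δ : ℕ → ℝ, Tendsto δ atTop (𝓝 0) ∧ ∀ i, ∀ᶠ n in atTop, Q i n (δ n) := by
  classical
  -- Diagonal choice: at `n`, take the largest `j ≤ n` for which the first properties up to `j` hold
  -- with loss `1 / (j + 1)`.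
  let R : ℕ → ℕ → Prop := fun n j => ∀ i ≤ j, Q i n (1 / ((j : ℝ) + 1))
  have hR : ∀ j, ∀ᶠ n in atTop, R n j ∧ j ≤ n := fun j =>
    (((Set.finite_Iic j).eventually_all.2 fun i _ => hQ i _ (by positivity))).and
      (eventually_ge_atTop j)
  let J : ℕ → ℕ := fun n => Nat.findGreatest (R n) n
  refine ⟨fun n => 1 / ((J n : ℝ) + 1), ?_, fun i => ?_⟩
  · have hJ : Tendsto J atTop atTop := tendsto_atTop.2 fun j =>
      (hR j).mono fun n hn => Nat.le_findGreatest hn.2 hn.1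
    exact tendsto_one_div_add_atTop_nhds_zero_nat.comp hJ
  · filter_upwards [hR i] with n hn
    exact Nat.findGreatest_spec (P := R n) hn.2 hn.1 i (Nat.le_findGreatest hn.2 hn.1)

/-! ### Additive spanners and the main theorem -/

/-- The graphs on `n` vertices with at most `M` edges can be coded by words of length
`M * (2 * (log n + 1))`. -/
lemma exists_code_of_card_edges_le (n M : ℕ) :
    Nonempty ({H : SimpleGraph (Fin n) // H.edgeSet.ncard ≤ M} ↪
      (Fin (M * (2 * (Nat.log 2 n + 1))) → Bool)) := by
  classical
  -- An edge set is listed in `M` slots, with `none` in the unused ones. A slot has at most `n ^ 2 +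
  -- 1` values, hence the `2 * (log n + 1)` bits.
  let F : (Fin M → Option (Sym2 (Fin n))) → Set (Sym2 (Fin n)) := fun a => {x | ∃ i, a i = some x}
  have hF : ∀ H : {H : SimpleGraph (Fin n) // H.edgeSet.ncard ≤ M}, ∃ a, F a = H.1.edgeSet := by
    rintro ⟨H, hH⟩
    rw [Set.ncard_eq_toFinset_card'] at hH
    let e := H.edgeSet.toFinset.equivFin
    refine ⟨fun i => if h : i.1 < H.edgeSet.toFinset.card then some (e.symm ⟨i, h⟩).1 else none, ?_⟩
    ext x
    simp only [F, Set.mem_ofPred_eq]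
    constructor
    · rintro ⟨i, hi⟩
      split_ifs at hi with h
      · rw [← Option.some.inj hi]
        exact Set.mem_toFinset.1 (e.symm ⟨i, h⟩).2
    · intro hx
      have hx' := Set.mem_toFinset.2 hx
      refine ⟨⟨(e ⟨x, hx'⟩).1, (e ⟨x, hx'⟩).2.trans_le hH⟩, ?_⟩
      rw [dif_pos (e ⟨x, hx'⟩).2]
      simp
  choose a ha using hF
  have hinj : Function.Injective a := by
    intro H H' h
    refine Subtype.ext (SimpleGraph.edgeSet_injective ?_)
    rw [← ha H, ← ha H', h]
  rw [Function.Embedding.nonempty_iff_card_le]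
  refine (Fintype.card_le_of_injective a hinj).trans ?_
  simp only [Fintype.card_fun, Fintype.card_option, Fintype.card_fin, Fintype.card_bool]
  rw [mul_comm M, pow_mul]
  refine Nat.pow_le_pow_left ?_ M
  have h1 : Fintype.card (Sym2 (Fin n)) ≤ n ^ 2 := by
    have := Fintype.card_le_of_surjective (Function.uncurry Sym2.mk : Fin n × Fin n → Sym2 (Fin n))
      Sym2.mk_surjective
    simpa [sq] using this
  have h2 : n < 2 ^ (Nat.log 2 n + 1) := Nat.lt_pow_succ_log_self (by norm_num) n
  calc Fintype.card (Sym2 (Fin n)) + 1 ≤ n ^ 2 + 1 := by omega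
    _ ≤ (2 ^ (Nat.log 2 n + 1)) ^ 2 := Nat.pow_lt_pow_left h2 two_ne_zero
    _ = _ := by rw [← pow_mul, mul_comm]

/-- Sparse additive spanners serve as a data structure. -/
lemma exists_dataStructure_of_spanners {g n M β : ℕ}
    (h : ∀ G : GraphOfGirthAtLeast g n, ∃ H : SimpleGraph (Fin n),
      IsAdditiveSpanner β G.1 H ∧ H.edgeSet.ncard ≤ M) :
    ∃ S : ApproxDistanceDataStructure g n (fun d => (d : ℝ≥0) + β),
      ∀ G, (S.encode G).length = M * (2 * (Nat.log 2 n + 1)) := by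
  choose H hH hM using h
  obtain ⟨e⟩ := exists_code_of_card_edges_le n M
  let code : {H : SimpleGraph (Fin n) // H.edgeSet.ncard ≤ M} → List Bool := fun H =>
    List.ofFn (e H)
  have hcode : Function.Injective code := fun H H' h => e.injective (List.ofFn_injective h)
  let dec : List Bool → Fin n → Fin n → ℝ≥0∞ := Function.extend code
    (fun H u v => ((H.1.edist u v : ℕ∞) : ℝ≥0∞)) 0
  have hdec : ∀ G, dec (code ⟨H G, hM G⟩) = fun u v => (((H G).edist u v : ℕ∞) : ℝ≥0∞) :=
    fun G => hcode.extend_apply _ _ _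
  refine ⟨⟨fun G => code ⟨H G, hM G⟩, dec, fun G u v => ?_, fun G u v huv => ?_⟩, fun G => ?_⟩
  · rw [hdec]
    exact ENat.toENNReal_le.2 (SimpleGraph.edist_anti (hH G).1)
  · rw [hdec]
    have h1 := (hH G).2 u v
    rw [← huv.coe_dist_eq_edist] at h1
    have h2 := ENat.toENNReal_le.2 h1
    simpa using h2
  · simp [code]

lemma exists_natLog_add_one_le {η : ℝ} (hη : 0 < η) :
    ∃ K : ℝ, 0 < K ∧ ∀ n : ℕ, 1 ≤ n → ((Nat.log 2 n + 1 : ℕ) : ℝ) ≤ K * (n : ℝ) ^ η := by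
  have hlog2 : 0 < Real.log 2 := Real.log_pos (by norm_num)
  refine ⟨1 / (η * Real.log 2) + 1, by positivity, fun n hn => ?_⟩
  have h1 : (Nat.log 2 n : ℝ) ≤ Real.logb 2 n := by exact_mod_cast Real.natLog_le_logb n 2
  have h2 : Real.log n ≤ (n : ℝ) ^ η / η := Real.log_le_rpow_div (by positivity) hη
  have h3 : (1 : ℝ) ≤ (n : ℝ) ^ η := Real.one_le_rpow (by exact_mod_cast hn) hη.le
  have h4 : Real.logb 2 n ≤ 1 / (η * Real.log 2) * (n : ℝ) ^ η := by
    rw [Real.logb]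
    calc Real.log n / Real.log 2 ≤ ((n : ℝ) ^ η / η) / Real.log 2 := by gcongr
      _ = _ := by field_simp
  push_cast
  rw [add_mul, one_mul]
  linarith

/-- The lower bound for additive spanners. -/
lemma eventually_exists_dense_spanners (hGirth : GirthConjecture) {γ : ℕ} (hγ : 1 ≤ γ) (β : ℕ)
    {ε : ℝ} (hε : 0 < ε) (C : ℝ) :
    ∀ᶠ n : ℕ in atTop, ∃ G : GraphOfGirthAtLeast (2 * γ + 1) n,
      ∀ H : SimpleGraph (Fin n), IsAdditiveSpanner β G.1 H →
        C * (n : ℝ) ^ (1 + 1 / (2 * (γ : ℝ) + 1) - ε) < (H.edgeSet.ncard : ℝ) := by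
  have hγ0 : (0 : ℝ) < γ := by exact_mod_cast hγ
  set e : ℝ := 1 + 1 / (2 * (γ : ℝ) + 1) with he
  -- Half the critical constant for `k = 2`. Any positive constant below the critical one would do,
  -- since `β` is eventually less than `c * d ^ (1/2)`.
  set c : ℝ := 1 / ((γ : ℝ) * (((2 : ℕ) : ℝ) - 1)) ^ (1 - 1 / ((2 : ℕ) : ℝ)) with hc
  have hbase : (0 : ℝ) < (γ : ℝ) * (((2 : ℕ) : ℝ) - 1) := by norm_num; omega
  have hc0 : 0 < c := by positivity
  have hclt : c < 2 / ((γ : ℝ) * (((2 : ℕ) : ℝ) - 1)) ^ (1 - 1 / ((2 : ℕ) : ℝ)) := by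
    rw [hc]
    gcongr
    norm_num
  obtain ⟨d₀, hd₀⟩ := eventually_atTop.1
    (((tendsto_rpow_atTop (by norm_num : (0 : ℝ) < 1 - 1 / ((2 : ℕ) : ℝ))).comp
      tendsto_natCast_atTop_atTop).eventually_gt_atTop (β / c))
  -- The logarithm from coding edges is absorbed into `n ^ (ε / 4)`; the data structure bound is
  -- used with loss `ε / 2`.
  obtain ⟨K, hK0, hK⟩ := exists_natLog_add_one_le (by positivity : 0 < ε / 4)
  have hC : 0 < max C 1 := by positivity
  filter_upwards [eventually_exists_long_encoding hGirth hγ le_rfl hclt d₀ (half_pos hε),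
    eventually_const_mul_rpow_le (2 * max C 1 * K + 1) (x := e - ε + ε / 4) (y := e - ε / 2)
      (by linarith), eventually_ge_atTop 1] with n hn hbound hn1
  have hn0 : (0 : ℝ) < n := by exact_mod_cast hn1
  by_contra! hcon
  have hsp : ∀ G : GraphOfGirthAtLeast (2 * γ + 1) n, ∃ H : SimpleGraph (Fin n),
      IsAdditiveSpanner β G.1 H ∧ H.edgeSet.ncard ≤ ⌊max C 1 * (n : ℝ) ^ (e - ε)⌋₊ := by
    intro G
    obtain ⟨H, hH, hle⟩ := hcon G
    refine ⟨H, hH, Nat.le_floor (hle.trans ?_)⟩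
    gcongr
    exact le_max_left _ _
  obtain ⟨S, hS⟩ := exists_dataStructure_of_spanners hsp
  obtain ⟨G, hG⟩ := hn _ (fun d hd => by
    have h1 := hd₀ d hd
    rw [div_lt_iff₀ hc0] at h1
    simp only [Function.comp_apply] at h1
    push_cast at h1 ⊢
    linarith) S
  rw [hS G] at hG
  have hexp : 1 + 1 / (((γ : ℝ) + 1) * 2 ^ (2 - 1) - 1) = e := by
    rw [he]
    norm_num
    ring
  rw [hexp] at hG
  have hfl : ((⌊max C 1 * (n : ℝ) ^ (e - ε)⌋₊ : ℕ) : ℝ) ≤ max C 1 * (n : ℝ) ^ (e - ε) :=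
    Nat.floor_le (by positivity)
  have hlen : ((⌊max C 1 * (n : ℝ) ^ (e - ε)⌋₊ * (2 * (Nat.log 2 n + 1)) : ℕ) : ℝ) ≤
      2 * max C 1 * K * (n : ℝ) ^ (e - ε + ε / 4) := by
    calc ((⌊max C 1 * (n : ℝ) ^ (e - ε)⌋₊ * (2 * (Nat.log 2 n + 1)) : ℕ) : ℝ)
        = ((⌊max C 1 * (n : ℝ) ^ (e - ε)⌋₊ : ℕ) : ℝ) * (2 * ((Nat.log 2 n + 1 : ℕ) : ℝ)) := by
          push_cast; ring
      _ ≤ (max C 1 * (n : ℝ) ^ (e - ε)) * (2 * (K * (n : ℝ) ^ (ε / 4))) := by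
          gcongr
          exact hK n hn1
      _ = _ := by rw [Real.rpow_add hn0]; ring
  have hpos : 0 < (n : ℝ) ^ (e - ε + ε / 4) := by positivity
  linarith

theorem mainTheorem6 (hGirth : GirthConjecture) :
    (∀ γ k : ℕ, 1 ≤ γ → 2 ≤ k →
      ∃ δ : ℕ → ℝ, Tendsto δ atTop (𝓝 0) ∧
        ∀ c : ℝ, c < 2 / ((γ : ℝ) * ((k : ℝ) - 1)) ^ (1 - 1 / (k : ℝ)) →
        ∀ d₀ : ℕ, ∀ᶠ n : ℕ in atTop,
          ∀ f : ℕ → ℝ≥0,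
            (∀ d : ℕ, d₀ ≤ d → (f d : ℝ) < (d : ℝ) + c * (d : ℝ) ^ (1 - 1 / (k : ℝ))) →
            ∀ D : ApproxDistanceDataStructure (2 * γ + 1) n f,
              ∃ G : GraphOfGirthAtLeast (2 * γ + 1) n,
                (n : ℝ) ^ (1 + 1 / (((γ : ℝ) + 1) * 2 ^ (k - 1) - 1) - δ n)
                  ≤ ((D.encode G).length : ℝ)) ∧
    (∀ γ : ℕ, 1 ≤ γ → ∀ (β : ℕ) (ε C : ℝ), 0 < ε →
      ∀ᶠ n : ℕ in atTop,
        ∃ G : GraphOfGirthAtLeast (2 * γ + 1) n,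
          ∀ H : SimpleGraph (Fin n), IsAdditiveSpanner β G.1 H →
            C * (n : ℝ) ^ (1 + 1 / (2 * (γ : ℝ) + 1) - ε) < (H.edgeSet.ncard : ℝ)) := by
  refine ⟨fun γ k hγ hk => ?_, fun γ hγ β ε C hε =>
    eventually_exists_dense_spanners hGirth hγ β hε C⟩
  set b : ℝ := 2 / ((γ : ℝ) * ((k : ℝ) - 1)) ^ (1 - 1 / (k : ℝ)) with hb
  -- One `δ` has to serve all `c` and `d₀`. The countably many cases `c = b - 1 / (i + 1)`, `d₀ = i`
  -- dominate all others.
  obtain ⟨δ, hδ, hQ⟩ := exists_tendsto_zero_eventually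
    (fun i n ε => ∀ f : ℕ → ℝ≥0,
      (∀ d : ℕ, i ≤ d → (f d : ℝ) <
        (d : ℝ) + (b - 1 / ((i : ℝ) + 1)) * (d : ℝ) ^ (1 - 1 / (k : ℝ))) →
      ∀ S : ApproxDistanceDataStructure (2 * γ + 1) n f,
        ∃ G : GraphOfGirthAtLeast (2 * γ + 1) n,
          (n : ℝ) ^ (1 + 1 / (((γ : ℝ) + 1) * 2 ^ (k - 1) - 1) - ε) ≤ ((S.encode G).length : ℝ))
    (fun i ε hε => eventually_exists_long_encoding hGirth hγ hk
      (sub_lt_self _ (by positivity)) i hε)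
  refine ⟨δ, hδ, fun c hc d₀ => ?_⟩
  obtain ⟨i, hi⟩ := (((tendsto_one_div_add_atTop_nhds_zero_nat (𝕜 := ℝ)).eventually_lt_const
    (sub_pos.2 hc)).and (eventually_ge_atTop d₀)).exists
  filter_upwards [hQ i] with n hn f hf S
  refine hn f (fun d hd => (hf d (hi.2.trans hd)).trans_le ?_) S
  gcongr
  linarith [hi.1]
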